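/- Let $q\ge 2$ and let $T$ be the homogeneous tree in which every vertex has $q+1$ neighbours, with graph distance $d$, a reference vertex $o$ and a fixed geodesic ray $\omega_*$ emanating from $o$. For a vertex $x$ let $x\wedge\omega_*$ be the point of $\omega_*$ closest to $x$, let $\ell(x)=d(o,x\wedge\omega_*)-d(x,x\wedge\omega_*)$ be its level, $\mathfrak p(x)$ its only neighbour of level $\ell(x)+1$, and $\mathrm{succ}(x)$ the set of its other neighbours; write $y\le x$ if $d(x,y)=\ell(x)-\ell(y)$. Let $\mu$ be the measure on $T$ with $\mu(\{x\})=q^{\ell(x)}$. Let $\nabla f(x)=f(x)-f(\mathfrak p(x))$ and $$\mathcal L f(x)=f(x)-\frac1{2\sqrt q}\sum_{y\sim x}\frac{\mu(y)^{1/2}}{\mu(x)^{1/2}}f(y),$$ which are bounded on $L^2(\mu)$; let $\mathcal R=\nabla\mathcal L^{-1/2}$ be the Riesz transform, where $\mathcal L^{-1/2}$ is defined by the spectral theorem and $\mathcal R$ is extended by continuity from the dense domain of $\mathcal L^{-1/2}$ to a bounded operator on $L^2(\mu)$, and let $\mathcal R^*$ be its adjoint on $L^2(\mu)$. An admissible trapezoid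 is a singleton or a set $\{x\le x_0:\ \ell(x_0)-h''<\ell(x)\le\ell(x_0)-h'\}$ with $x_0\in T$ and positive integers $h',h''$ such that $2\le h''/h'\le 12$. Let $\|f\|_{BMO(\mu)}$ be the supremum over the admissible trapezoids $F$ of $\mu(F)^{-1}\sum_{x\in F}|f(x)-f_F|\,\mu(x)$, where $f_F$ is the $\mu$-mean of $f$ on $F$, and let $BMO(\mu)$ be the space of functions for which it is finite. A $(1,\infty)$-atom is a function supported on an admissible trapezoid $F$, bounded by $\mu(F)^{-1}$ and of $\mu$-mean zero. $H^1(\mu)$ is the space of the $g\in L^1(\mu)$ of the form $g=\sum_j\lambda_ja_j$ with $(1,\infty)$-atoms $a_j$ and $\sum_j|\lambda_j|<\infty$, with norm the infimum of $\sum_j|\lambda_j|$ over such representations. Then: 1. $\mathcal R$ does not map $L^\infty(\mu)$ into $BMO(\mu)$: there is $f\in L^2(\mu)\cap L^\infty(\mu)$ with $\mathcal Rf\notin BMO(\mu)$. In particular there is no constant $C<\infty$ with $\|\mathcal Rf\|_{BMO(\mu)}\le C\|f\|_{L^\infty(\mu)}$ for all $f\in L^2(\mu)\cap L^\infty(\mu)$.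 2. Let $x_1\ne x_2$ be in $\mathrm{succ}(o)$, $a=\delta_{x_1}-\delta_{x_2}$, and for $N\ge0$ let $f_N$ be the indicator function of $\{y\le x_1:\ d(x_1,y)\le N\}$. Then $a$ is a $(1,\infty)$-atom, $$\sum_{x\in T}\mathcal Rf_N(x)\,a(x)\,\mu(x)=\frac{2\sqrt2}{\pi q}\sum_{n=1}^{N+1}\frac{n}{n^2-\frac14}\ \longrightarrow\ +\infty\qquad(N\to\infty),$$ and $\mathcal R^*a\notin L^1(\mu)$. 3. $\mathcal R^*$ is not bounded from $H^1(\mu)$ to $L^1(\mu)$: there is $g\in L^2(\mu)\cap H^1(\mu)$ with $\mathcal R^*g\notin L^1(\mu)$, and there is no constant $C<\infty$ with $\|\mathcal R^*g\|_{L^1(\mu)}\le C\|g\|_{H^1(\mu)}$ for all $g\in L^2(\mu)\cap H^1(\mu)$. -/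

import Mathlib

open MeasureTheory Filter
open scoped ENNReal NNReal

noncomputable section

section FunctionalCalculus

variable {H : Type*} [NormedAddCommGroup H] [InnerProductSpace ℂ H] [CompleteSpace H]

/-- The square root `A^{1/2}` of a nonnegative self-adjoint operator on a Hilbert space, through the
functional calculus. -/
def operatorSqrt (A : H →L[ℂ] H) : H →L[ℂ] H := cfc Real.sqrt A

/-- The operator `A^{-1/2}`, for `A` injective, nonnegative and self-adjoint: the (in general
unbounded) inverse of `A^{1/2}`, whose domain is the range of `A^{1/2}`. -/
def operatorInvSqrt (A : H →L[ℂ] H) : H →ₗ.[ℂ] H :=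
  ((operatorSqrt A : H →ₗ[ℂ] H).toPMap ⊤).inverse

end FunctionalCalculus

/-- The homogeneous tree in which every vertex has `q + 1` neighbours, together with a reference
vertex and a boundary point (the mythical ancestor), given by a geodesic ray that emanates from the
reference vertex. -/
structure HomogeneousTree (V : Type*) (q : ℕ) where
  graph : SimpleGraph V
  isTree : graph.IsTree
  ncard_neighborSet : ∀ x, (graph.neighborSet x).ncard = q + 1
  origin : V
  ancestor : ℕ → V
  ancestor_zero : ancestor 0 = origin
  dist_ancestor : ∀ m n, graph.dist (ancestor m) (ancestor (m + n)) = n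

namespace HomogeneousTree

variable {V : Type*} {q : ℕ} (T : HomogeneousTree V q)

/-- `x ∧ ω`, the point of the ray `ω` of the mythical ancestor that is closest to `x`. -/
def confluent (x : V) : V :=
  T.ancestor (Function.argmin fun n => T.graph.dist x (T.ancestor n))

/-- The level `ℓ(x) = d(o, x ∧ ω) - d(x, x ∧ ω)`. -/
def level (x : V) : ℤ :=
  (T.graph.dist T.origin (T.confluent x) : ℤ) - (T.graph.dist x (T.confluent x) : ℤ)

/-- The predecessor of `x`: the only neighbour of `x` of level `ℓ(x) + 1`. -/
def pred (x : V) : V :=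
  @Classical.epsilon V ⟨x⟩ fun y => T.graph.Adj x y ∧ T.level y = T.level x + 1

/-- The successors of `x`: the neighbours other than the predecessor. -/
def succs (x : V) : Set V := {y | T.graph.Adj x y ∧ y ≠ T.pred x}

/-- The descendants of `x`: the vertices `y ≤ x`, that is, `d(x, y) = ℓ(x) - ℓ(y)`. -/
def descendants (x : V) : Set V := {y | (T.graph.dist x y : ℤ) = T.level x - T.level y}

/-- The density `μ(x) = q ^ ℓ(x)` of the canonical flow. -/
def flow (x : V) : ℝ := (q : ℝ) ^ T.level x

/-- The canonical flow measure `μ`, that is, the measure with `μ {x} = q ^ ℓ(x)`. -/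
def flowMeasure [MeasurableSpace V] : Measure V :=
  Measure.count.withDensity fun x => ENNReal.ofReal (T.flow x)

/-- The flow gradient `∇ f (x) = f(x) - f(𝔭(x))`. -/
def gradient (f : V → ℂ) (x : V) : ℂ := f x - f (T.pred x)

/-- The flow Laplacian
`𝓛 f (x) = f(x) - (2 √q)⁻¹ ∑_{y ∼ x} μ(y)^{1/2} μ(x)^{-1/2} f(y)`. -/
def laplacian (f : V → ℂ) (x : V) : ℂ :=
  f x - 1 / (2 * (√(q : ℝ) : ℂ)) *
    ∑ᶠ y ∈ T.graph.neighborSet x, ((√(T.flow y) / √(T.flow x) : ℝ) : ℂ) * f y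

section Operators

variable [MeasurableSpace V]

/-- The Hilbert space `L²(μ)`. -/
abbrev L2 : Type _ := Lp ℂ 2 T.flowMeasure

open scoped Classical in
/-- The bounded operator on `L²(μ)` that acts on functions as `A` (and `0` if `A` does not define a
bounded linear operator on `L²(μ)`). -/
def onL2 (A : (V → ℂ) → V → ℂ) : T.L2 →L[ℂ] T.L2 :=
  if h : ∃ B : T.L2 →L[ℂ] T.L2, ∀ f : T.L2, B f =ᵐ[T.flowMeasure] A f then h.choose else 0

/-- The flow gradient as a bounded operator on `L²(μ)`. -/
def gradientL2 : T.L2 →L[ℂ] T.L2 := T.onL2 T.gradient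

/-- The flow Laplacian as a bounded (self-adjoint) operator on `L²(μ)`. -/
def laplacianL2 : T.L2 →L[ℂ] T.L2 := T.onL2 T.laplacian

/-- The operator `𝓛^{-1/2}` on `L²(μ)`. -/
def invSqrtLaplacian : T.L2 →ₗ.[ℂ] T.L2 := operatorInvSqrt T.laplacianL2

/-- The Riesz transform `𝓡 = ∇ 𝓛^{-1/2}`, extended by continuity from the (dense) domain of
`𝓛^{-1/2}` to the whole of `L²(μ)`. -/
def riesz : T.L2 →L[ℂ] T.L2 :=
  ((T.gradientL2 : T.L2 →ₗ[ℂ] T.L2) ∘ₗ T.invSqrtLaplacian.toFun).extendOfNorm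
    T.invSqrtLaplacian.domain.subtype

/-- The adjoint `𝓡^*` of the Riesz transform with respect to the inner product of `L²(μ)`. -/
def rieszAdjoint : T.L2 →L[ℂ] T.L2 := ContinuousLinearMap.adjoint T.riesz

end Operators

/-- The set `F_{h'}^{h''}(x₀)`. -/
def trapezoid (x₀ : V) (h' h'' : ℕ) : Set V :=
  {x | x ∈ T.descendants x₀ ∧ T.level x₀ - h'' < T.level x ∧ T.level x ≤ T.level x₀ - h'}

/-- Admissible trapezoids: singletons, and the sets `F_{h'}^{h''}(x₀)` with `2 ≤ h'' / h' ≤ 12`. -/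
def IsAdmissible (F : Set V) : Prop :=
  (∃ x, F = {x}) ∨
    ∃ (x₀ : V) (h' h'' : ℕ), 0 < h' ∧ 2 * h' ≤ h'' ∧ h'' ≤ 12 * h' ∧ F = T.trapezoid x₀ h' h''

section Spaces

variable [MeasurableSpace V]

/-- The `BMO(μ)` seminorm, the supremum over the admissible trapezoids `F` of the mean over `F` of
`|f - f_F|`. -/
def bmoSeminorm (f : V → ℂ) : ℝ≥0∞ :=
  ⨆ (F : Set V) (_ : T.IsAdmissible F),
    ⨍⁻ x in F, ‖f x - ⨍ y in F, f y ∂T.flowMeasure‖ₑ ∂T.flowMeasure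

/-- Membership in `BMO(μ)`. -/
def MemBMO (f : V → ℂ) : Prop := T.bmoSeminorm f < ∞

/-- `(1, ∞)`-atoms. -/
def IsAtom (a : V → ℂ) : Prop :=
  ∃ F : Set V, T.IsAdmissible F ∧ Function.support a ⊆ F ∧
    (∀ x, ‖a x‖ ≤ (T.flowMeasure.real F)⁻¹) ∧ ∫ x, a x ∂T.flowMeasure = 0

/-- `g = ∑ⱼ cⱼ aⱼ` with atoms `aⱼ` and an `ℓ¹` sequence of complex numbers `cⱼ`. -/
def IsAtomicDecomposition (g : V → ℂ) (c : ℕ → ℂ) (a : ℕ → V → ℂ) : Prop :=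
  (Summable fun j => ‖c j‖) ∧ (∀ j, T.IsAtom (a j)) ∧ ∀ x, HasSum (fun j => c j * a j x) (g x)

/-- Membership in the atomic Hardy space `H¹(μ)`. -/
def MemHardy (g : V → ℂ) : Prop :=
  MemLp g 1 T.flowMeasure ∧ ∃ c a, T.IsAtomicDecomposition g c a

/-- The norm of `H¹(μ)`: the infimum of `∑ⱼ |cⱼ|` over the atomic decompositions. -/
def hardyNorm (g : V → ℂ) : ℝ≥0∞ :=
  ⨅ (c : ℕ → ℂ) (a : ℕ → V → ℂ) (_ : T.IsAtomicDecomposition g c a), ∑' j, ‖c j‖ₑ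

end Spaces

end HomogeneousTree

end

/-! The map `S f = f ∘ 𝔭` is an isometry of `L²(μ)`, because the `q` successors of a vertex share
its mass equally. In terms of it `∇ = 1 - S` and `𝓛 = 1 - (S + S†)/2`. Hence `‖(1 - S) f‖ = √2
‖𝓛^{1/2} f‖`, so `𝓡` is well defined, and `𝓡 𝓛^{1/2} = 1 - S`. Taking adjoints, `𝓛^{1/2} 𝓡† a = a`
whenever `S† a = 0`, which holds for `a = δ_x - δ_y` with `x`, `y` siblings.

For such `a` the vectors `Sⁿ a` are orthogonal, and on their closed span `𝓛` is the Dirichlet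
Laplacian of a half-line, diagonalised by `sin((n+1)θ)` with eigenvalue `1 - cos θ`. Since `sin θ /
√(1 - cos θ) = √2 cos(θ/2)`, this gives `𝓡† a = ∑ cₙ Sⁿ a` with `cₙ = (2√2/π) ∫₀^π cos(θ/2)
sin((n+1)θ) dθ`, which is of order `1/n`: square summable, not summable (`hasSum_rieszAdjoint`,
`tendsto_sum_rieszCoeff_atTop`).

Now `Sⁿ δ_x` is the indicator of the `n`-th generation below `x`, always of mass `μ(x)`. Pairing `a`
with `𝓡` of the indicator of generations `0, …, N` below `x` therefore gives `μ(x) ∑_{n ≤ N} cₙ`,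
which diverges (`inner_vertexDiff_riesz`). This excludes `𝓡† a ∈ L¹`. For a single bounded `f` with
`𝓡 f ∉ BMO`, such sets of growing depth are placed in disjoint subtrees of summable mass
(`exists_not_memBMO_riesz`). -/

/-! ### Levels, predecessors and descendants in the tree -/

theorem SimpleGraph.IsTree.eq_of_adj_of_dist_lt {V : Type*} {G : SimpleGraph V} (hG : G.IsTree)
    {u x y z : V} (hy : G.Adj x y) (hz : G.Adj x z)
    (hyu : G.dist y u + 1 = G.dist x u) (hzu : G.dist z u + 1 = G.dist x u) : y = z := by
  obtain ⟨p, hp⟩ := hG.connected.exists_walk_length_eq_dist y u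
  obtain ⟨r, hr⟩ := hG.connected.exists_walk_length_eq_dist z u
  have hp' : (SimpleGraph.Walk.cons hy p).IsPath :=
    SimpleGraph.Walk.isPath_of_length_eq_dist _ (by simp [hp, hyu])
  have hr' : (SimpleGraph.Walk.cons hz r).IsPath :=
    SimpleGraph.Walk.isPath_of_length_eq_dist _ (by simp [hr, hzu])
  have h := (hG.existsUnique_path x u).unique hp' hr'
  simpa using congrArg SimpleGraph.Walk.snd h

theorem SimpleGraph.Connected.exists_adj_dist_add_one {V : Type*} {G : SimpleGraph V}
    (hG : G.Connected) {x u : V} (hxu : x ≠ u) : ∃ y, G.Adj x y ∧ G.dist y u + 1 = G.dist x u := by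
  obtain ⟨p, hp⟩ := hG.exists_walk_length_eq_dist x u
  cases p with
  | nil => exact absurd rfl hxu
  | @cons _ y _ hxy p =>
    refine ⟨y, hxy, ?_⟩
    have h1 := SimpleGraph.dist_le p
    have h2 := hG.dist_triangle (u := x) (v := y) (w := u)
    rw [SimpleGraph.dist_eq_one_iff_adj.2 hxy] at h2
    simp only [SimpleGraph.Walk.length_cons] at hp
    omega

namespace HomogeneousTree

variable {V : Type*} {q : ℕ} (T : HomogeneousTree V q)

theorem adj_ancestor (n : ℕ) : T.graph.Adj (T.ancestor n) (T.ancestor (n + 1)) :=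
  SimpleGraph.dist_eq_one_iff_adj.1 (T.dist_ancestor n 1)

theorem dist_ancestor_succ (x : V) (n : ℕ) :
    T.graph.dist x (T.ancestor n) = T.graph.dist x (T.ancestor (n + 1)) + 1 ∨
      T.graph.dist x (T.ancestor (n + 1)) = T.graph.dist x (T.ancestor n) + 1 :=
  T.isTree.dist_eq_dist_add_one_of_adj x (T.adj_ancestor n)

/-- If the distance rose and then fell, the middle vertex of the ray would have two neighbours
closer to `x`, which a tree forbids. So the distance to the ray, once it increases, increases
forever. -/
theorem dist_ancestor_succ_succ (x : V) (n : ℕ)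
    (h : T.graph.dist x (T.ancestor (n + 1)) = T.graph.dist x (T.ancestor n) + 1) :
    T.graph.dist x (T.ancestor (n + 2)) = T.graph.dist x (T.ancestor (n + 1)) + 1 := by
  rcases T.dist_ancestor_succ x (n + 1) with h' | h'
  · have := T.isTree.eq_of_adj_of_dist_lt (u := x) (T.adj_ancestor n).symm
      (T.adj_ancestor (n + 1))
      (by rw [SimpleGraph.dist_comm, SimpleGraph.dist_comm (v := x)]; exact h.symm)
      (by rw [SimpleGraph.dist_comm, SimpleGraph.dist_comm (v := x)]; exact h'.symm)
    have h2 := T.dist_ancestor n 2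
    rw [this] at h2
    simp [show n + 1 + 1 = n + 2 from rfl] at h2
  · exact h'

/-- The level is a Busemann function: beyond the point of the ray closest to `x`, the distance grows
by one at each step. Comparing vertices at a common far ancestor reduces statements about levels to
statements about distances. -/
theorem exists_level_eq (x : V) :
    ∃ m : ℕ, ∀ n, m ≤ n → T.level x = n - T.graph.dist x (T.ancestor n) := by
  set m := Function.argmin fun n => T.graph.dist x (T.ancestor n) with hm
  have hmin : ∀ n, T.graph.dist x (T.ancestor m) ≤ T.graph.dist x (T.ancestor n) :=
    fun n => Function.argmin_le (fun n => T.graph.dist x (T.ancestor n)) n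
  have hstep : ∀ k, T.graph.dist x (T.ancestor (m + k + 1)) =
      T.graph.dist x (T.ancestor (m + k)) + 1 := by
    intro k
    induction k with
    | zero =>
      have h1 := hmin (m + 1)
      have h2 := T.dist_ancestor_succ x m
      simp only [add_zero]
      omega
    | succ k ih => exact T.dist_ancestor_succ_succ x _ ih
  have hdist : ∀ k, T.graph.dist x (T.ancestor (m + k)) = T.graph.dist x (T.ancestor m) + k := by
    intro k
    induction k with
    | zero => rfl
    | succ k ih => rw [← add_assoc, hstep, ih, add_assoc]
  have h0 : T.graph.dist T.origin (T.ancestor m) = m := by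
    have := T.dist_ancestor 0 m
    rwa [zero_add, T.ancestor_zero] at this
  refine ⟨m, fun n hn => ?_⟩
  obtain ⟨k, rfl⟩ := Nat.exists_eq_add_of_le hn
  rw [hdist, level, confluent, ← hm, h0]
  push_cast
  ring

theorem sub_dist_ancestor_le_level (x : V) (n : ℕ) :
    (n : ℤ) - T.graph.dist x (T.ancestor n) ≤ T.level x := by
  obtain ⟨m, hm⟩ := T.exists_level_eq x
  rw [hm (n + m) (by omega)]
  have h1 := T.isTree.connected.dist_triangle (u := x) (v := T.ancestor n)
    (w := T.ancestor (n + m))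
  rw [T.dist_ancestor n m] at h1
  push_cast
  omega

theorem level_origin : T.level T.origin = 0 := by
  obtain ⟨m, hm⟩ := T.exists_level_eq T.origin
  have := T.dist_ancestor 0 m
  rw [zero_add, T.ancestor_zero] at this
  rw [hm m le_rfl, this, sub_self]

theorem level_adj {x y : V} (h : T.graph.Adj x y) :
    T.level y = T.level x + 1 ∨ T.level x = T.level y + 1 := by
  obtain ⟨m, hm⟩ := T.exists_level_eq x
  obtain ⟨k, hk⟩ := T.exists_level_eq y
  rw [hm (m + k) (by omega), hk (m + k) (by omega)]
  have := T.isTree.dist_eq_dist_add_one_of_adj (T.ancestor (m + k)) h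
  rw [SimpleGraph.dist_comm, SimpleGraph.dist_comm (v := y)] at this
  omega

theorem abs_level_sub_le_dist (x y : V) : |T.level x - T.level y| ≤ T.graph.dist x y := by
  obtain ⟨m, hm⟩ := T.exists_level_eq x
  obtain ⟨k, hk⟩ := T.exists_level_eq y
  rw [hm (m + k) (by omega), hk (m + k) (by omega), abs_le]
  have h1 := T.isTree.connected.dist_triangle (u := x) (v := y) (w := T.ancestor (m + k))
  have h2 := T.isTree.connected.dist_triangle (u := y) (v := x) (w := T.ancestor (m + k))
  rw [SimpleGraph.dist_comm (u := y) (v := x)] at h2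
  omega

theorem eq_of_adj_of_level_eq {x y z : V} (hy : T.graph.Adj x y) (hz : T.graph.Adj x z)
    (hyl : T.level y = T.level x + 1) (hzl : T.level z = T.level x + 1) : y = z := by
  obtain ⟨m, hm⟩ := T.exists_level_eq x
  obtain ⟨k, hk⟩ := T.exists_level_eq y
  obtain ⟨l, hl⟩ := T.exists_level_eq z
  rw [hm (m + k + l) (by omega), hk (m + k + l) (by omega)] at hyl
  rw [hm (m + k + l) (by omega), hl (m + k + l) (by omega)] at hzl
  exact T.isTree.eq_of_adj_of_dist_lt (u := T.ancestor (m + k + l)) hy hz (by omega) (by omega)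

theorem exists_adj_level_eq (x : V) : ∃ y, T.graph.Adj x y ∧ T.level y = T.level x + 1 := by
  obtain ⟨m, hm⟩ := T.exists_level_eq x
  -- Large enough that `n > ℓ(x)`, so that `x` is not itself the ancestor `n`; the neighbour of `x`
  -- towards that ancestor then has level `ℓ(x) + 1`.
  set n := m + (T.level x).toNat + 1 with hn
  have hx := hm n (by omega)
  have hne : x ≠ T.ancestor n := by
    intro h
    rw [h, SimpleGraph.dist_self, ← h] at hx
    omega
  obtain ⟨y, hxy, hy⟩ := T.isTree.connected.exists_adj_dist_add_one hne
  refine ⟨y, hxy, ?_⟩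
  have h1 := T.sub_dist_ancestor_le_level y n
  have h2 := T.level_adj hxy
  omega

theorem pred_spec (x : V) : T.graph.Adj x (T.pred x) ∧ T.level (T.pred x) = T.level x + 1 :=
  @Classical.epsilon_spec_aux V ⟨x⟩ _ (T.exists_adj_level_eq x)

theorem adj_pred (x : V) : T.graph.Adj x (T.pred x) := (T.pred_spec x).1

theorem level_pred (x : V) : T.level (T.pred x) = T.level x + 1 := (T.pred_spec x).2

theorem level_iterate_pred (n : ℕ) (x : V) : T.level (T.pred^[n] x) = T.level x + n := by
  induction n with
  | zero => simp
  | succ n ih => rw [Function.iterate_succ_apply', level_pred, ih]; push_cast; ring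

theorem eq_pred {x y : V} (h : T.graph.Adj x y) (hl : T.level y = T.level x + 1) :
    y = T.pred x :=
  T.eq_of_adj_of_level_eq h (T.adj_pred x) hl (T.level_pred x)

theorem mem_succs_iff {x y : V} : y ∈ T.succs x ↔ T.pred y = x := by
  constructor
  · rintro ⟨h, hne⟩
    rcases T.level_adj h with h' | h'
    · exact absurd (T.eq_pred h h') hne
    · exact (T.eq_pred h.symm h').symm
  · rintro rfl
    refine ⟨(T.adj_pred y).symm, fun h => ?_⟩
    have h1 := T.level_pred (T.pred y)
    rw [← h, T.level_pred] at h1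
    omega

theorem finite_neighborSet (x : V) : (T.graph.neighborSet x).Finite :=
  Set.finite_of_ncard_ne_zero (by rw [T.ncard_neighborSet]; omega)

theorem neighborSet_eq (x : V) : T.graph.neighborSet x = insert (T.pred x) (T.succs x) := by
  ext y
  simp only [SimpleGraph.mem_neighborSet, Set.mem_insert_iff, succs, Set.mem_ofPred_eq]
  constructor
  · intro h
    exact (em _).imp id fun h' => ⟨h, h'⟩
  · rintro (rfl | h)
    exacts [T.adj_pred x, h.1]

theorem pred_notMem_succs (x : V) : T.pred x ∉ T.succs x := fun h => h.2 rfl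

theorem finite_succs (x : V) : (T.succs x).Finite :=
  (T.finite_neighborSet x).subset (by rw [neighborSet_eq]; exact Set.subset_insert _ _)

theorem ncard_succs (x : V) : (T.succs x).ncard = q := by
  have h := T.ncard_neighborSet x
  rw [neighborSet_eq, Set.ncard_insert_of_notMem (T.pred_notMem_succs x) (T.finite_succs x)] at h
  omega

theorem succs_eq_preimage (x : V) : T.succs x = T.pred ⁻¹' {x} := by
  ext y
  exact T.mem_succs_iff

theorem exists_ne_mem_succs (hq : 2 ≤ q) (x : V) :
    ∃ y z, y ∈ T.succs x ∧ z ∈ T.succs x ∧ y ≠ z := by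
  have h : 1 < (T.succs x).ncard := by rw [ncard_succs]; omega
  obtain ⟨y, z, hy, hz, hyz⟩ := (Set.one_lt_ncard_iff (T.finite_succs x)).1 h
  exact ⟨y, z, hy, hz, hyz⟩

theorem dist_iterate_pred_le (n : ℕ) (x : V) : T.graph.dist (T.pred^[n] x) x ≤ n := by
  induction n with
  | zero => simp
  | succ n ih =>
    have h := T.isTree.connected.dist_triangle (u := T.pred^[n + 1] x) (v := T.pred^[n] x) (w := x)
    have h' := SimpleGraph.dist_eq_one_iff_adj.2 (T.adj_pred (T.pred^[n] x)).symm
    rw [Function.iterate_succ_apply'] at h ⊢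
    omega

theorem dist_iterate_pred (n : ℕ) (x : V) : T.graph.dist (T.pred^[n] x) x = n := by
  have h := T.abs_level_sub_le_dist (T.pred^[n] x) x
  rw [level_iterate_pred, add_sub_cancel_left, Nat.abs_cast] at h
  have := T.dist_iterate_pred_le n x
  omega

/-- The first step from `y` towards `x` must raise the level, since a level difference never exceeds
a distance; so it leads to the predecessor. -/
theorem iterate_pred_eq_of_mem_descendants {x y : V} (h : y ∈ T.descendants x) :
    T.pred^[T.graph.dist x y] y = x := by
  generalize hn : T.graph.dist x y = n
  induction n generalizing y with
  | zero => exact (T.isTree.connected.dist_eq_zero_iff.1 hn).symm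
  | succ n ih =>
    have h' : (T.graph.dist x y : ℤ) = T.level x - T.level y := h
    have hne : y ≠ x := by
      rintro rfl
      simp at hn
    obtain ⟨z, hyz, hz⟩ := T.isTree.connected.exists_adj_dist_add_one hne
    rw [SimpleGraph.dist_comm, SimpleGraph.dist_comm (u := y)] at hz
    have h1 := le_abs_self (T.level x - T.level z) |>.trans (T.abs_level_sub_le_dist x z)
    have h2 := T.level_adj hyz
    have hl : T.level z = T.level y + 1 := by omega
    obtain rfl := T.eq_pred hyz hl
    rw [Function.iterate_succ_apply]
    refine ih ?_ (by omega)
    change (T.graph.dist x (T.pred y) : ℤ) = _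
    omega

theorem mem_descendants_dist_le_iff {x y : V} {N : ℕ} :
    (y ∈ T.descendants x ∧ T.graph.dist x y ≤ N) ↔ ∃ n ≤ N, T.pred^[n] y = x := by
  constructor
  · rintro ⟨h, hN⟩
    exact ⟨_, hN, T.iterate_pred_eq_of_mem_descendants h⟩
  · rintro ⟨n, hn, rfl⟩
    refine ⟨?_, by rwa [dist_iterate_pred]⟩
    change (T.graph.dist _ y : ℤ) = _
    rw [dist_iterate_pred, level_iterate_pred]
    ring

/-- Makes every sibling set an admissible trapezoid; this is the only kind that the counterexamples
use. -/
theorem trapezoid_one_two (x : V) : T.trapezoid x 1 2 = T.succs x := by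
  ext y
  rw [mem_succs_iff]
  constructor
  · rintro ⟨h, h1, h2⟩
    have h' : (T.graph.dist x y : ℤ) = T.level x - T.level y := h
    have := T.iterate_pred_eq_of_mem_descendants h
    rwa [show T.graph.dist x y = 1 by push_cast at h1 h2; omega] at this
  · rintro rfl
    refine ⟨(T.mem_descendants_dist_le_iff (N := 1) |>.2 ⟨1, le_rfl, rfl⟩).1, ?_, ?_⟩ <;>
    · rw [level_pred]
      push_cast
      omega

theorem isAdmissible_succs (x : V) : T.IsAdmissible (T.succs x) :=
  Or.inr ⟨x, 1, 2, by norm_num, by norm_num, by norm_num, (T.trapezoid_one_two x).symm⟩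

end HomogeneousTree

/-! ### Sine moments and polynomial approximation -/

/-- The sine moment `∫₀^π f(1 - cos θ) cos(θ/2) sin(nθ) dθ`. -/
noncomputable def sineMoment (f : ℝ → ℝ) (n : ℕ) : ℝ :=
  ∫ θ in (0 : ℝ)..Real.pi, f (1 - Real.cos θ) * (Real.cos (θ / 2) * Real.sin (n * θ))

theorem sineMoment_zero (f : ℝ → ℝ) : sineMoment f 0 = 0 := by
  simp [sineMoment]

theorem continuous_sineMoment_integrand {f : ℝ → ℝ} (hf : Continuous f) (n : ℕ) :
    Continuous fun θ : ℝ => f (1 - Real.cos θ) * (Real.cos (θ / 2) * Real.sin (n * θ)) := by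
  fun_prop

theorem sineMoment_add {f g : ℝ → ℝ} (hf : Continuous f) (hg : Continuous g) (n : ℕ) :
    sineMoment (fun x => f x + g x) n = sineMoment f n + sineMoment g n := by
  simp only [sineMoment]
  rw [← intervalIntegral.integral_add
    ((continuous_sineMoment_integrand hf n).intervalIntegrable _ _)
    ((continuous_sineMoment_integrand hg n).intervalIntegrable _ _)]
  simp only [add_mul]

theorem sineMoment_const_mul (c : ℝ) (f : ℝ → ℝ) (n : ℕ) :
    sineMoment (fun x => c * f x) n = c * sineMoment f n := by
  simp only [sineMoment]
  rw [← intervalIntegral.integral_const_mul]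
  simp only [mul_assoc]

/-- Since `cos θ sin((n+1)θ)` is the mean of `sin((n+2)θ)` and `sin(nθ)`, multiplication by `1 - cos
θ` acts on the moments as the half-line Laplacian, with the Dirichlet condition supplied by
`sineMoment_zero`. -/
theorem sineMoment_mul_id {f : ℝ → ℝ} (hf : Continuous f) (n : ℕ) :
    sineMoment (fun x => x * f x) (n + 1) = sineMoment f (n + 1) -
      (sineMoment f (n + 2) + sineMoment f n) / 2 := by
  have hi := fun k => (continuous_sineMoment_integrand hf k).intervalIntegrable
    (μ := volume) 0 Real.pi
  simp only [sineMoment]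
  rw [← intervalIntegral.integral_add (hi _) (hi _), ← intervalIntegral.integral_div,
    ← intervalIntegral.integral_sub (hi _) (((hi _).add (hi _)).div_const 2)]
  refine intervalIntegral.integral_congr fun θ _ => ?_
  have h1 : Real.sin (((n + 2 : ℕ) : ℝ) * θ) =
      Real.sin (((n + 1 : ℕ) : ℝ) * θ) * Real.cos θ +
        Real.cos (((n + 1 : ℕ) : ℝ) * θ) * Real.sin θ := by
    rw [← Real.sin_add]; push_cast; ring_nf
  have h2 : Real.sin ((n : ℝ) * θ) =
      Real.sin (((n + 1 : ℕ) : ℝ) * θ) * Real.cos θ -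
        Real.cos (((n + 1 : ℕ) : ℝ) * θ) * Real.sin θ := by
    rw [← Real.sin_sub]; push_cast; ring_nf
  simp only [h1, h2]
  ring

theorem sineMoment_one (n : ℕ) :
    sineMoment (fun _ => 1) (n + 1) = ((n : ℝ) + 1) / (((n : ℝ) + 1) ^ 2 - 1 / 4) := by
  have hn : (0 : ℝ) ≤ n := n.cast_nonneg
  have h1 : (n : ℝ) + 3 / 2 ≠ 0 := by positivity
  have h2 : (n : ℝ) + 1 / 2 ≠ 0 := by positivity
  -- Antiderivative from the product formula `2 cos(θ/2) sin((n+1)θ) = sin((n+3/2)θ) +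
  -- sin((n+1/2)θ)`; both of its cosines vanish at `π`.
  have hd : ∀ θ : ℝ, HasDerivAt (fun θ : ℝ => -(Real.cos ((n + 3 / 2) * θ) / (n + 3 / 2) +
      Real.cos ((n + 1 / 2) * θ) / (n + 1 / 2)) / 2)
      (1 * (Real.cos (θ / 2) * Real.sin ((n + 1 : ℕ) * θ))) θ := by
    intro θ
    have e := fun c : ℝ => ((hasDerivAt_id θ).const_mul c).cos
    convert! ((((e (n + 3 / 2)).div_const ((n : ℝ) + 3 / 2)).add
      ((e (n + 1 / 2)).div_const ((n : ℝ) + 1 / 2))).neg.div_const 2) using 1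
    simp only [id, mul_one]
    rw [show ((n : ℝ) + 3 / 2) * θ = (n + 1) * θ + θ / 2 by ring,
      show ((n : ℝ) + 1 / 2) * θ = (n + 1) * θ - θ / 2 by ring, Real.sin_add, Real.sin_sub]
    field_simp
    push_cast
    ring
  rw [sineMoment, intervalIntegral.integral_eq_sub_of_hasDerivAt (fun θ _ => hd θ)
    (Continuous.intervalIntegrable (by fun_prop) _ _)]
  have c1 : Real.cos (((n : ℝ) + 3 / 2) * Real.pi) = 0 :=
    Real.cos_eq_zero_iff.2 ⟨n + 1, by push_cast; ring⟩
  have c2 : Real.cos (((n : ℝ) + 1 / 2) * Real.pi) = 0 :=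
    Real.cos_eq_zero_iff.2 ⟨n, by push_cast; ring⟩
  rw [c1, c2]
  simp only [mul_zero, Real.cos_zero]
  rw [show ((n : ℝ) + 1) ^ 2 - 1 / 4 = (n + 3 / 2) * (n + 1 / 2) by ring]
  field_simp
  ring

theorem integral_cos_nat_mul (n : ℕ) :
    ∫ θ in (0 : ℝ)..Real.pi, Real.cos (n * θ) = if n = 0 then Real.pi else 0 := by
  split_ifs with h
  · simp [h]
  · have h' : (n : ℝ) ≠ 0 := by exact_mod_cast h
    rw [intervalIntegral.integral_comp_mul_left _ h']
    simp [Real.sin_nat_mul_pi]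

/-- On `[0, π]` one has `√(1 - cos θ) cos(θ/2) = (√2/2) sin θ`, so this is the orthogonality of the
sines. It will say that `𝓛^{1/2}` maps `∑ cₙ Sⁿ a` to `a`. -/
theorem sineMoment_sqrt (n : ℕ) :
    sineMoment Real.sqrt (n + 1) = if n = 0 then √2 * Real.pi / 4 else 0 := by
  have h : ∀ θ ∈ Set.uIcc 0 Real.pi, √(1 - Real.cos θ) *
      (Real.cos (θ / 2) * Real.sin ((n + 1 : ℕ) * θ)) =
      √2 / 4 * (Real.cos ((n : ℕ) * θ) - Real.cos ((n + 2 : ℕ) * θ)) := by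
    intro θ hθ
    rw [Set.uIcc_of_le Real.pi_pos.le] at hθ
    have hs : 0 ≤ Real.sin (θ / 2) :=
      Real.sin_nonneg_of_nonneg_of_le_pi (by linarith [hθ.1]) (by linarith [hθ.2, Real.pi_pos])
    have h1 : 1 - Real.cos θ = 2 * Real.sin (θ / 2) ^ 2 := by
      have := Real.cos_two_mul (θ / 2)
      rw [mul_div_cancel₀ _ two_ne_zero] at this
      linarith [Real.sin_sq_add_cos_sq (θ / 2)]
    have h2 := Real.sin_two_mul (θ / 2)
    rw [mul_div_cancel₀ _ two_ne_zero] at h2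
    have h3 : Real.cos ((n : ℕ) * θ) = Real.cos ((n + 1 : ℕ) * θ) * Real.cos θ +
        Real.sin ((n + 1 : ℕ) * θ) * Real.sin θ := by
      rw [← Real.cos_sub]; push_cast; ring_nf
    have h4 : Real.cos ((n + 2 : ℕ) * θ) = Real.cos ((n + 1 : ℕ) * θ) * Real.cos θ -
        Real.sin ((n + 1 : ℕ) * θ) * Real.sin θ := by
      rw [← Real.cos_add]; push_cast; ring_nf
    rw [h1, Real.sqrt_mul zero_le_two, Real.sqrt_sq hs, h3, h4, h2]
    ring
  rw [sineMoment, intervalIntegral.integral_congr h, intervalIntegral.integral_const_mul,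
    intervalIntegral.integral_sub (Continuous.intervalIntegrable (by fun_prop) _ _)
      (Continuous.intervalIntegrable (by fun_prop) _ _), integral_cos_nat_mul,
    integral_cos_nat_mul]
  split_ifs <;> simp_all
  ring

theorem abs_sineMoment_sub_le {f g : ℝ → ℝ} (hf : Continuous f) (hg : Continuous g) {ε : ℝ}
    (h : ∀ x ∈ Set.Icc (-2 : ℝ) 2, |f x - g x| ≤ ε) (n : ℕ) :
    |sineMoment f n - sineMoment g n| ≤ ε * Real.pi := by
  rw [sineMoment, sineMoment, ← intervalIntegral.integral_sub
    ((continuous_sineMoment_integrand hf n).intervalIntegrable _ _)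
    ((continuous_sineMoment_integrand hg n).intervalIntegrable _ _), ← Real.norm_eq_abs]
  have hε : 0 ≤ ε := (abs_nonneg _).trans (h 0 (by norm_num))
  refine (intervalIntegral.norm_integral_le_of_norm_le_const (C := ε) fun θ _ => ?_).trans
    (by rw [sub_zero, abs_of_pos Real.pi_pos])
  rw [← sub_mul, norm_mul, norm_mul, Real.norm_eq_abs, Real.norm_eq_abs, Real.norm_eq_abs]
  have h1 := h (1 - Real.cos θ)
    ⟨by linarith [Real.cos_le_one θ], by linarith [Real.neg_one_le_cos θ]⟩
  have h2 : |Real.cos (θ / 2)| * |Real.sin (n * θ)| ≤ 1 :=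
    mul_le_one₀ (Real.abs_cos_le_one _) (abs_nonneg _) (Real.abs_sin_le_one _)
  calc _ ≤ ε * 1 := by gcongr
    _ = ε := mul_one ε

theorem exists_polynomial_tendsto_cfc {H : Type*} [NormedAddCommGroup H] [InnerProductSpace ℂ H]
    [CompleteSpace H] {A : H →L[ℂ] H} (hA : IsSelfAdjoint A) {r : ℝ} (hr : ‖A‖ ≤ r)
    {f : ℝ → ℝ} (hf : Continuous f) :
    ∃ p : ℕ → Polynomial ℝ, (∀ k, ∀ x ∈ Set.Icc (-r) r, |(p k).eval x - f x| ≤ 1 / (k + 1)) ∧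
      Tendsto (fun k => Polynomial.aeval A (p k)) atTop (nhds (cfc f A)) := by
  have hp : ∀ k : ℕ, ∃ p : Polynomial ℝ,
      ∀ x ∈ Set.Icc (-r) r, |p.eval x - f x| < 1 / ((k : ℝ) + 1) := fun k =>
    exists_polynomial_near_of_continuousOn _ _ f hf.continuousOn _ Nat.one_div_pos_of_nat
  choose p hp using hp
  refine ⟨p, fun k x hx => (hp k x hx).le, ?_⟩
  rw [tendsto_iff_norm_sub_tendsto_zero]
  refine squeeze_zero (fun _ => norm_nonneg _) (fun k => ?_) tendsto_one_div_add_atTop_nhds_zero_nat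
  rw [← cfc_polynomial (p k) A, ← cfc_sub _ _ A]
  refine norm_cfc_le (by positivity) fun x hx => ?_
  have h1 : ‖x‖ ≤ r := (spectrum.norm_le_norm_mul_of_mem hx).trans
    ((mul_le_of_le_one_right (norm_nonneg _) ContinuousLinearMap.norm_id_le).trans hr)
  rw [Real.norm_eq_abs] at h1
  simpa using (hp k x (abs_le.1 h1)).le

/-! ### The Laplacian of an isometry and its inverse square root on wandering vectors -/

section Isometry

open ContinuousLinearMap

variable {H : Type*} [NormedAddCommGroup H] [InnerProductSpace ℂ H] [CompleteSpace H]

/-- The Laplacian `1 - (S + S†) / 2` of an isometry `S`. -/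
noncomputable def isometryLaplacian (S : H →L[ℂ] H) : H →L[ℂ] H :=
  1 - (1 / 2 : ℂ) • (S + adjoint S)

theorem isometryLaplacian_apply (S : H →L[ℂ] H) (x : H) :
    isometryLaplacian S x = x - (1 / 2 : ℂ) • (S x + adjoint S x) := rfl

theorem isSelfAdjoint_isometryLaplacian (S : H →L[ℂ] H) : IsSelfAdjoint (isometryLaplacian S) := by
  rw [isSelfAdjoint_iff, isometryLaplacian, star_sub, star_one, star_smul, star_add,
    star_eq_adjoint, star_eq_adjoint, adjoint_adjoint, add_comm (adjoint S)]
  congr 2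
  simp

theorem inner_isometryLaplacian_left (S : H →L[ℂ] H) (x y : H) :
    inner ℂ (isometryLaplacian S x) y = inner ℂ x (isometryLaplacian S y) :=
  (isSelfAdjoint_isometryLaplacian S).isSymmetric x y

theorem isSelfAdjoint_operatorSqrt (A : H →L[ℂ] H) : IsSelfAdjoint (operatorSqrt A) :=
  cfc_predicate Real.sqrt A

theorem inner_operatorSqrt_left (A : H →L[ℂ] H) (x y : H) :
    inner ℂ (operatorSqrt A x) y = inner ℂ x (operatorSqrt A y) :=
  (isSelfAdjoint_operatorSqrt A).isSymmetric x y

variable {S : H →L[ℂ] H}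

theorem inner_isometry_apply (hS : ∀ x, adjoint S (S x) = x) (x y : H) : inner ℂ (S x) (S y) = inner ℂ x y := by
  rw [← adjoint_inner_right, hS]

theorem norm_isometry_apply (hS : ∀ x, adjoint S (S x) = x) (x : H) : ‖S x‖ = ‖x‖ := by
  rw [@norm_eq_sqrt_re_inner ℂ, inner_isometry_apply hS, ← @norm_eq_sqrt_re_inner ℂ]

theorem norm_isometryLaplacian_le (hS : ∀ x, adjoint S (S x) = x) : ‖isometryLaplacian S‖ ≤ 2 := by
  have h : ‖S‖ ≤ 1 := S.opNorm_le_bound zero_le_one fun x => by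
    rw [norm_isometry_apply hS, one_mul]
  have h1 : ‖adjoint S‖ ≤ 1 := by
    rwa [LinearIsometryEquiv.norm_map]
  calc ‖isometryLaplacian S‖ ≤ ‖(1 : H →L[ℂ] H)‖ + ‖(1 / 2 : ℂ)‖ * ‖S + adjoint S‖ := by
        rw [← norm_smul]; exact norm_sub_le _ _
    _ ≤ 1 + (1 / 2) * (1 + 1) := by
        have h2 := (norm_add_le S (adjoint S)).trans (add_le_add h h1)
        have h3 : ‖(1 : H →L[ℂ] H)‖ ≤ 1 := norm_id_le
        have h4 : ‖(1 / 2 : ℂ)‖ = 1 / 2 := by simp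
        rw [h4]
        gcongr
    _ = 2 := by norm_num

theorem inner_sub_isometry_self (hS : ∀ x, adjoint S (S x) = x) (x : H) :
    inner ℂ (x - S x) (x - S x) = 2 * inner ℂ x (isometryLaplacian S x) := by
  rw [isometryLaplacian_apply, inner_sub_left, inner_sub_right, inner_sub_right,
    inner_isometry_apply hS, inner_sub_right, inner_smul_right, inner_add_right,
    adjoint_inner_right]
  ring

theorem isPositive_isometryLaplacian (hS : ∀ x, adjoint S (S x) = x) : (isometryLaplacian S).IsPositive := by
  refine (isPositive_iff_complex _).2 fun x => ?_
  have h := inner_sub_isometry_self hS x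
  rw [← inner_isometryLaplacian_left, inner_self_eq_norm_sq_to_K] at h
  have h3 : inner ℂ (isometryLaplacian S x) x = ((‖x - S x‖ ^ 2 / 2 : ℝ) : ℂ) := by
    push_cast
    rw [eq_div_iff two_ne_zero, mul_comm, ← h]
    rfl
  rw [h3]
  rw [RCLike.re_eq_complex_re, Complex.ofReal_re]
  exact ⟨rfl, by positivity⟩

theorem operatorSqrt_operatorSqrt {A : H →L[ℂ] H} (hA : A.IsPositive) (x : H) :
    operatorSqrt A (operatorSqrt A x) = A x := by
  have h : operatorSqrt A * operatorSqrt A = A := by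
    have hsa : IsSelfAdjoint A := hA.isSelfAdjoint
    have hnn : 0 ≤ A := (nonneg_iff_isPositive A).2 hA
    rw [operatorSqrt, ← cfc_mul Real.sqrt Real.sqrt A]
    conv_rhs => rw [← cfc_id ℝ A]
    exact cfc_congr fun y hy => Real.mul_self_sqrt (spectrum_nonneg_of_nonneg hnn hy)
  exact congrArg (fun B : H →L[ℂ] H => B x) h

theorem operatorSqrt_injective {A : H →L[ℂ] H} (hA : A.IsPositive)
    (hinj : ∀ x, A x = 0 → x = 0) (x : H) (hx : operatorSqrt A x = 0) : x = 0 :=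
  hinj x (by rw [← operatorSqrt_operatorSqrt hA, hx, map_zero])

/-- Makes `(1 - S) A^{-1/2}`, with `A` the Laplacian of `S`, bounded with constant `√2` on its
domain, which is what its extension by continuity requires. -/
theorem norm_sub_isometry_eq (hS : ∀ x, adjoint S (S x) = x) (x : H) :
    ‖x - S x‖ = √2 * ‖operatorSqrt (isometryLaplacian S) x‖ := by
  have h := inner_sub_isometry_self hS x
  rw [← operatorSqrt_operatorSqrt (isPositive_isometryLaplacian hS), ← inner_operatorSqrt_left,
    inner_self_eq_norm_sq_to_K,
    inner_self_eq_norm_sq_to_K] at h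
  have h' : ‖x - S x‖ ^ 2 = 2 * ‖operatorSqrt (isometryLaplacian S) x‖ ^ 2 := by
    rw [← Complex.ofReal_inj]
    push_cast
    exact h
  rw [← Real.sqrt_sq (norm_nonneg (x - S x)), h', Real.sqrt_mul zero_le_two,
    Real.sqrt_sq (norm_nonneg _)]

theorem ker_operatorSqrt {A : H →L[ℂ] H} (hA : A.IsPositive) (hinj : ∀ x, A x = 0 → x = 0) :
    LinearMap.ker ((operatorSqrt A : H →ₗ[ℂ] H).toPMap ⊤).toFun = ⊥ := by
  rw [LinearMap.ker_eq_bot']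
  rintro ⟨x, hx⟩ h
  ext
  exact operatorSqrt_injective hA hinj x h

/-- The orthogonal complement of the range of a self-adjoint operator is its kernel, here trivial.
-/
theorem denseRange_operatorSqrt {A : H →L[ℂ] H} (hA : A.IsPositive)
    (hinj : ∀ x, A x = 0 → x = 0) : DenseRange (operatorSqrt A) := by
  have h : (LinearMap.range (operatorSqrt A : H →ₗ[ℂ] H))ᗮ = ⊥ := by
    rw [Submodule.eq_bot_iff]
    intro x hx
    refine operatorSqrt_injective hA hinj x (ext_inner_left ℂ fun y => ?_)
    rw [inner_zero_right, ← inner_operatorSqrt_left]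
    exact (Submodule.mem_orthogonal _ _).1 hx _ ⟨y, rfl⟩
  exact Submodule.dense_iff_topologicalClosure_eq_top.2
    (Submodule.topologicalClosure_eq_top_iff.2 h)

theorem extendOfNorm_operatorInvSqrt (hS : ∀ x, adjoint S (S x) = x) (hinj : ∀ x, isometryLaplacian S x = 0 → x = 0) (x : H) :
    (((1 - S : H →L[ℂ] H) : H →ₗ[ℂ] H) ∘ₗ
      (operatorInvSqrt (isometryLaplacian S)).toFun).extendOfNorm
        (operatorInvSqrt (isometryLaplacian S)).domain.subtype
        (operatorSqrt (isometryLaplacian S) x) = x - S x := by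
  set A := isometryLaplacian S
  have hA : A.IsPositive := isPositive_isometryLaplacian hS
  have hker := ker_operatorSqrt hA hinj
  have hdom : ∀ y, y ∈ (operatorInvSqrt A).domain ↔ ∃ x, operatorSqrt A x = y := by
    intro y
    rw [operatorInvSqrt, LinearPMap.inverse_domain]
    constructor
    · rintro ⟨⟨x, _⟩, h⟩
      exact ⟨x, h⟩
    · rintro ⟨x, h⟩
      exact ⟨⟨x, trivial⟩, h⟩
  have happ : ∀ (y : (operatorInvSqrt A).domain) (x : H), operatorSqrt A x = y →
      operatorInvSqrt A y = x := fun y x hxy =>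
    LinearPMap.inverse_apply_eq (f := (operatorSqrt A : H →ₗ[ℂ] H).toPMap ⊤) hker
      (x := ⟨x, trivial⟩) hxy
  have hdense : DenseRange (operatorInvSqrt A).domain.subtype := by
    rw [DenseRange, Submodule.coe_subtype, Subtype.range_coe]
    refine (denseRange_operatorSqrt hA hinj).mono ?_
    rintro _ ⟨x, rfl⟩
    exact (hdom _).2 ⟨x, rfl⟩
  have hmem : operatorSqrt A x ∈ (operatorInvSqrt A).domain := (hdom _).2 ⟨x, rfl⟩
  have h := LinearMap.extendOfNorm_eq (f := ((1 - S : H →L[ℂ] H) : H →ₗ[ℂ] H) ∘ₗ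
    (operatorInvSqrt A).toFun) hdense ⟨√2, fun y => ?_⟩ ⟨_, hmem⟩
  · refine h.trans ?_
    change (1 - S : H →L[ℂ] H) (operatorInvSqrt A ⟨_, hmem⟩) = _
    rw [happ ⟨_, hmem⟩ x rfl]
    rfl
  · obtain ⟨z, hz⟩ := (hdom y).1 y.2
    change ‖(1 - S : H →L[ℂ] H) (operatorInvSqrt A y)‖ ≤ √2 * ‖(y : H)‖
    rw [happ y z hz, ← hz, ← norm_sub_isometry_eq hS]
    rfl

/-- The adjoint of `R A^{1/2} = 1 - S` is `A^{1/2} R† = 1 - S†`, and `S†` kills `a`. -/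
theorem adjoint_apply_of_comp_operatorSqrt {R : H →L[ℂ] H}
    (hR : ∀ x, R (operatorSqrt (isometryLaplacian S) x) = x - S x) {a : H}
    (ha : adjoint S a = 0) :
    operatorSqrt (isometryLaplacian S) (adjoint R a) = a := by
  refine ext_inner_right ℂ fun y => ?_
  rw [inner_operatorSqrt_left, adjoint_inner_left, hR, inner_sub_right, ← adjoint_inner_left, ha, inner_zero_left, sub_zero]

theorem isometryLaplacian_iterate_succ (hS : ∀ x, adjoint S (S x) = x) {a : H} (n : ℕ) :
    isometryLaplacian S ((⇑S)^[n + 1] a) =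
      (⇑S)^[n + 1] a - (1 / 2 : ℂ) • ((⇑S)^[n + 2] a + (⇑S)^[n] a) := by
  rw [isometryLaplacian_apply]
  congr 3
  · exact (Function.iterate_succ_apply' S (n + 1) a).symm
  · rw [Function.iterate_succ_apply']; exact hS _

theorem isometryLaplacian_apply_of_adjoint_eq_zero {a : H} (ha : adjoint S a = 0) :
    isometryLaplacian S a = a - (1 / 2 : ℂ) • S a := by
  rw [isometryLaplacian_apply, ha, add_zero]

/-- The pairings with `Sⁿ a` and the sine moments obey the same three-term recurrence under
multiplication by the Laplacian and by `1 - cos θ` respectively, so agreement for the polynomial `1`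
propagates to all polynomials. -/
theorem inner_aeval_isometryLaplacian (hS : ∀ x, adjoint S (S x) = x) {a w : H} (ha : adjoint S a = 0) (κ : ℂ)
    (hw : ∀ n, inner ℂ ((⇑S)^[n] a) w = κ * sineMoment (fun _ => 1) (n + 1))
    (p : Polynomial ℝ) (n : ℕ) :
    inner ℂ ((⇑S)^[n] a) (Polynomial.aeval (isometryLaplacian S) p w) =
      κ * sineMoment (fun x => p.eval x) (n + 1) := by
  induction p using Polynomial.induction_on generalizing n with
  | C c =>
    have h := sineMoment_const_mul c (fun _ => 1) (n + 1)
    simp only [mul_one] at h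
    rw [Polynomial.aeval_C, Algebra.algebraMap_eq_smul_one]
    change inner ℂ _ (c • w) = _
    simp only [Polynomial.eval_C, h]
    rw [← Complex.coe_smul, inner_smul_right, hw]
    push_cast
    ring
  | add p q hp hq =>
    rw [map_add, add_apply, inner_add_right, hp, hq]
    simp only [Polynomial.eval_add]
    rw [sineMoment_add p.continuous q.continuous]
    push_cast
    ring
  | monomial k c h =>
    rw [pow_succ', mul_left_comm, map_mul, Polynomial.aeval_X, mul_apply_eq_comp,
      ← inner_isometryLaplacian_left]
    simp only [Polynomial.eval_mul (p := Polynomial.X), Polynomial.eval_X]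
    rw [sineMoment_mul_id (Polynomial.continuous _)]
    have hc : (starRingEnd ℂ) (1 / 2) = 1 / 2 := by rw [map_div₀, map_one, map_ofNat]
    -- At `n = 0` the lower neighbour is missing on both sides: `S† a = 0`, and the moment of index
    -- `0` vanishes.
    cases n with
    | zero =>
      have h1 := h 1
      rw [Function.iterate_one] at h1
      have h0 := h 0
      rw [Function.iterate_zero_apply] at h0
      rw [Function.iterate_zero_apply, isometryLaplacian_apply_of_adjoint_eq_zero ha, inner_sub_left,
        inner_smul_left, h1, h0, sineMoment_zero, hc]
      push_cast
      ring
    | succ n =>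
      rw [isometryLaplacian_iterate_succ hS, inner_sub_left, inner_smul_left, inner_add_left, h, h,
        h, hc]
      push_cast
      ring

/-- Polynomials approximating `f` uniformly on `[-2, 2]`, which contains both the spectrum and the
values of `1 - cos θ`, give convergence of both sides. -/
theorem inner_cfc_isometryLaplacian (hS : ∀ x, adjoint S (S x) = x) {a w : H} (ha : adjoint S a = 0) (κ : ℂ)
    (hw : ∀ n, inner ℂ ((⇑S)^[n] a) w = κ * sineMoment (fun _ => 1) (n + 1))
    {f : ℝ → ℝ} (hf : Continuous f) (n : ℕ) :
    inner ℂ ((⇑S)^[n] a) (cfc f (isometryLaplacian S) w) = κ * sineMoment f (n + 1) := by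
  obtain ⟨p, hp, hlim⟩ := exists_polynomial_tendsto_cfc (isSelfAdjoint_isometryLaplacian S)
    (norm_isometryLaplacian_le hS) hf
  have h1 : Tendsto (fun k => inner ℂ ((⇑S)^[n] a)
      (Polynomial.aeval (isometryLaplacian S) (p k) w)) atTop
      (nhds (inner ℂ ((⇑S)^[n] a) (cfc f (isometryLaplacian S) w))) := by
    have h : Continuous fun B : H →L[ℂ] H => inner ℂ ((⇑S)^[n] a) (B w) := by fun_prop
    exact (h.tendsto _).comp hlim
  have h2 : Tendsto (fun k => sineMoment (fun x => (p k).eval x) (n + 1)) atTop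
      (nhds (sineMoment f (n + 1))) := by
    rw [tendsto_iff_norm_sub_tendsto_zero]
    refine squeeze_zero (fun _ => norm_nonneg _) (fun k =>
      abs_sineMoment_sub_le (p k).continuous hf (hp k) (n + 1)) ?_
    simpa using tendsto_one_div_add_atTop_nhds_zero_nat.mul_const Real.pi
  simp only [inner_aeval_isometryLaplacian hS ha κ hw] at h1
  refine tendsto_nhds_unique h1 (Tendsto.const_mul κ ?_)
  exact (Complex.continuous_ofReal.tendsto _).comp h2

theorem inner_iterate_isometry (hS : ∀ x, adjoint S (S x) = x) {a : H} (ha : adjoint S a = 0) (m n : ℕ) :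
    inner ℂ ((⇑S)^[m] a) ((⇑S)^[n] a) = if m = n then (‖a‖ : ℂ) ^ 2 else 0 := by
  induction m generalizing n with
  | zero =>
    cases n with
    | zero => simp
    | succ n =>
      rw [Function.iterate_zero_apply, Function.iterate_succ_apply', ← adjoint_inner_left, ha, inner_zero_left]
      simp
  | succ m ih =>
    cases n with
    | zero =>
      rw [Function.iterate_zero_apply, Function.iterate_succ_apply', ← adjoint_inner_right, ha, inner_zero_right]
      simp
    | succ n =>
      rw [Function.iterate_succ_apply', Function.iterate_succ_apply', inner_isometry_apply hS, ih]
      simp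

/-- The coefficients `(2√2 / π) (n + 1) / ((n + 1)² - 1/4)` of `L^{-1/2} a` with respect to the
orthogonal vectors `Sⁿ a`. -/
noncomputable def rieszCoeff (n : ℕ) : ℝ :=
  2 * √2 / Real.pi * sineMoment (fun _ => 1) (n + 1)

theorem rieszCoeff_eq (n : ℕ) : rieszCoeff n =
    2 * √2 / Real.pi * (((n : ℝ) + 1) / (((n : ℝ) + 1) ^ 2 - 1 / 4)) := by
  rw [rieszCoeff, sineMoment_one]

theorem rieszCoeff_pos (n : ℕ) : 0 < rieszCoeff n := by
  have h : (0 : ℝ) < ((n : ℝ) + 1) ^ 2 - 1 / 4 := by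
    have : (0 : ℝ) ≤ n := n.cast_nonneg
    nlinarith
  rw [rieszCoeff_eq]
  have := Real.pi_pos
  positivity

/-- The bound `cₙ = O(1/n)` suffices for convergence of the orthogonal series in `L²`, although `∑
cₙ` diverges. -/
theorem summable_rieszCoeff_sq : Summable fun n => rieszCoeff n ^ 2 := by
  have h : Summable fun n : ℕ => (2 * √2 / Real.pi * 2) ^ 2 * (1 / ((n + 1 : ℕ) : ℝ) ^ 2) :=
    ((summable_nat_add_iff 1).2 (Real.summable_one_div_nat_pow.2 one_lt_two)).mul_left _
  refine Summable.of_nonneg_of_le (fun n => sq_nonneg _) (fun n => ?_) h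
  have hn : (0 : ℝ) ≤ n := n.cast_nonneg
  have h2 : ((n : ℝ) + 1) / (((n : ℝ) + 1) ^ 2 - 1 / 4) ≤ 2 * (1 / ((n + 1 : ℕ) : ℝ)) := by
    push_cast
    rw [mul_one_div, div_le_div_iff₀ (by nlinarith) (by positivity)]
    nlinarith
  have h3 : rieszCoeff n ≤ 2 * √2 / Real.pi * 2 * (1 / ((n + 1 : ℕ) : ℝ)) := by
    rw [rieszCoeff_eq, mul_assoc (_ / _)]
    have := Real.pi_pos
    gcongr
  calc rieszCoeff n ^ 2 ≤ _ := pow_le_pow_left₀ (rieszCoeff_pos n).le h3 2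
    _ = _ := by rw [mul_pow, one_div_pow]

theorem summable_rieszCoeff_smul (hS : ∀ x, adjoint S (S x) = x) {a : H} (ha : adjoint S a = 0) :
    Summable fun n => (rieszCoeff n : ℂ) • (⇑S)^[n] a := by
  have hV : OrthogonalFamily ℂ (fun n => (ℂ ∙ (⇑S)^[n] a : Submodule ℂ H))
      fun n => (ℂ ∙ (⇑S)^[n] a : Submodule ℂ H).subtypeₗᵢ := by
    refine OrthogonalFamily.of_pairwise fun m n hmn => ?_
    rw [Function.onFun, Submodule.isOrtho_span]
    rintro _ rfl _ rfl
    rw [inner_iterate_isometry hS ha, if_neg hmn]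
  have h := (hV.summable_iff_norm_sq_summable fun n =>
    ⟨(rieszCoeff n : ℂ) • (⇑S)^[n] a, Submodule.smul_mem _ _ (Submodule.mem_span_singleton_self _)⟩)
  refine h.2 ?_
  have hn : ∀ n, ‖(⇑S)^[n] a‖ = ‖a‖ := by
    intro n
    induction n with
    | zero => rfl
    | succ n ih => rw [Function.iterate_succ_apply', norm_isometry_apply hS, ih]
  simp only [Submodule.coe_norm, norm_smul, hn, mul_pow, Complex.norm_real, Real.norm_eq_abs, sq_abs]
  exact summable_rieszCoeff_sq.mul_right _

/-- The sum `w` of the series is shown to satisfy `Q w = a`, and injectivity of `Q` then identifies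
it with `u`. The moments only show that `Q w - a` is orthogonal to every `Sᵐ a`; that it vanishes
needs the same for `Q (Q w - a)`, because `w` lies in the closed span of the `Sᵐ a`. -/
theorem hasSum_rieszCoeff_smul (hS : ∀ x, adjoint S (S x) = x) (hinj : ∀ x, isometryLaplacian S x = 0 → x = 0) {a u : H}
    (ha : adjoint S a = 0) (hu : operatorSqrt (isometryLaplacian S) u = a) :
    HasSum (fun n => (rieszCoeff n : ℂ) • (⇑S)^[n] a) u := by
  obtain ⟨w, hw⟩ := summable_rieszCoeff_smul hS ha
  set Q := operatorSqrt (isometryLaplacian S) with hQ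
  have hinner : ∀ m, inner ℂ ((⇑S)^[m] a) w = ((‖a‖ : ℂ) ^ 2 * (2 * √2 / Real.pi : ℝ)) *
      sineMoment (fun _ => 1) (m + 1) := by
    intro m
    have h := hw.mapL (innerSL ℂ ((⇑S)^[m] a))
    have h' := hasSum_single (f := fun n => innerSL ℂ ((⇑S)^[m] a) ((rieszCoeff n : ℂ) • (⇑S)^[n] a))
      m fun n hn => by
        rw [innerSL_apply_apply, inner_smul_right, inner_iterate_isometry hS ha, if_neg hn.symm,
          mul_zero]
    rw [← innerSL_apply_apply, h.unique h', innerSL_apply_apply, inner_smul_right,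
      inner_iterate_isometry hS ha, if_pos rfl, rieszCoeff]
    push_cast
    ring
  have hQw : ∀ m, inner ℂ ((⇑S)^[m] a) (Q w - a) = 0 := by
    intro m
    have h2 := inner_iterate_isometry hS ha m 0
    rw [Function.iterate_zero_apply] at h2
    rw [inner_sub_right, hQ, operatorSqrt, inner_cfc_isometryLaplacian hS ha _ hinner
      Real.continuous_sqrt, sineMoment_sqrt, h2]
    split_ifs with hm
    · have h3 : (2 * √2 / Real.pi : ℝ) * (√2 * Real.pi / 4) = 1 := by
        have := Real.mul_self_sqrt (zero_le_two (α := ℝ))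
        field_simp
        nlinarith
      rw [mul_assoc, ← Complex.ofReal_mul, h3]
      simp
    · simp
  have hQr : ∀ m, inner ℂ ((⇑S)^[m] a) (Q (Q w - a)) = 0 := by
    intro m
    -- With `κ = 0` the moment identity says that functions of the Laplacian preserve the orthogonal
    -- complement of the `Sⁿ a`.
    have := inner_cfc_isometryLaplacian hS ha 0 (w := Q w - a) (fun n => by rw [hQw, zero_mul])
      Real.continuous_sqrt m
    rwa [zero_mul] at this
  -- `‖Q w - a‖² = ⟨w, Q (Q w - a)⟩ - ⟨a, Q w - a⟩`, and both terms vanish.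
  have hr : Q w - a = 0 := by
    rw [← inner_self_eq_zero (𝕜 := ℂ), inner_sub_left]
    have h1 : inner ℂ a (Q w - a) = 0 := hQw 0
    have h2 : inner ℂ (Q (Q w - a)) w = 0 := by
      rw [← innerSL_apply_apply]
      refine (hw.mapL (innerSL ℂ (Q (Q w - a)))).unique ?_
      convert! hasSum_zero using 2 with n
      rw [innerSL_apply_apply, inner_smul_right, inner_eq_zero_symm.1 (hQr n), mul_zero]
    rw [h1, hQ, inner_operatorSqrt_left, ← hQ,
      inner_eq_zero_symm.1 h2, sub_zero]
  have huw : u = w := by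
    rw [← sub_eq_zero]
    refine operatorSqrt_injective (isPositive_isometryLaplacian hS) hinj _ ?_
    rw [map_sub, hu, sub_eq_zero]
    exact (sub_eq_zero.1 hr).symm
  rwa [huw]

end Isometry

/-! ### The flow measure, the shift isometry and the series for the adjoint Riesz transform -/

namespace HomogeneousTree

variable {V : Type*} {q : ℕ} (T : HomogeneousTree V q)

theorem finite_setOf_dist_eq (n : ℕ) : {x | T.graph.dist T.origin x = n}.Finite := by
  induction n with
  | zero =>
    refine (Set.finite_singleton T.origin).subset fun x hx => ?_
    exact (T.isTree.connected.dist_eq_zero_iff.1 hx).symm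
  | succ n ih =>
    refine (ih.biUnion fun y _ => T.finite_neighborSet y).subset fun x hx => ?_
    have hx' : T.graph.dist T.origin x = n + 1 := hx
    have hne : x ≠ T.origin := by
      rintro rfl
      simp at hx'
    obtain ⟨y, hxy, hy⟩ := T.isTree.connected.exists_adj_dist_add_one hne
    rw [SimpleGraph.dist_comm, SimpleGraph.dist_comm (u := x)] at hy
    exact Set.mem_biUnion (show T.graph.dist T.origin y = n by omega) hxy.symm

theorem countable_vertices (T : HomogeneousTree V q) : Countable V := by
  rw [← Set.countable_univ_iff]
  refine (Set.countable_iUnion fun n => (T.finite_setOf_dist_eq n).countable).mono fun x _ => ?_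
  exact Set.mem_iUnion.2 ⟨_, rfl⟩

theorem flow_pos (hq : 0 < q) (x : V) : 0 < T.flow x :=
  zpow_pos (Nat.cast_pos.2 hq) _

theorem flow_pred (hq : 0 < q) (x : V) : T.flow (T.pred x) = q * T.flow x := by
  rw [flow, flow, level_pred, zpow_add_one₀ (Nat.cast_ne_zero.2 hq.ne'), mul_comm]

theorem flow_of_mem_succs (hq : 0 < q) {x y : V} (h : y ∈ T.succs x) :
    T.flow y = T.flow x / q := by
  have hq' : (q : ℝ) ≠ 0 := Nat.cast_ne_zero.2 hq.ne'
  rw [← T.mem_succs_iff.1 h, T.flow_pred hq, mul_div_cancel_left₀ _ hq']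

variable [MeasurableSpace V]

theorem L2_ext {f g : T.L2} (h : ∀ x, f x = g x) : f = g :=
  Lp.ext (Eventually.of_forall h)

variable [DiscreteMeasurableSpace V]

theorem flowMeasure_singleton (x : V) : T.flowMeasure {x} = ENNReal.ofReal (T.flow x) := by
  rw [flowMeasure, withDensity_apply _ (MeasurableSet.of_discrete), lintegral_singleton,
    Measure.count_singleton, mul_one]

theorem flowMeasure_real_singleton (hq : 0 < q) (x : V) : T.flowMeasure.real {x} = T.flow x := by
  rw [measureReal_def, flowMeasure_singleton, ENNReal.toReal_ofReal (T.flow_pos hq x).le]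

theorem flowMeasure_singleton_ne_top (x : V) : T.flowMeasure {x} ≠ ∞ := by
  rw [flowMeasure_singleton]
  exact ENNReal.ofReal_ne_top

/-- Every vertex has positive mass, so elements of `L²(μ)` may be handled as genuine functions. -/
theorem forall_of_ae (hq : 0 < q) {p : V → Prop} (h : ∀ᵐ x ∂T.flowMeasure, p x) (x : V) : p x := by
  by_contra hx
  have h1 : T.flowMeasure {x} = 0 := measure_mono_null (by rintro _ rfl; exact hx) (ae_iff.1 h)
  rw [flowMeasure_singleton, ENNReal.ofReal_eq_zero] at h1
  exact absurd h1 (not_le.2 (T.flow_pos hq x))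

theorem flowMeasure_succs (hq : 0 < q) (x : V) : T.flowMeasure (T.succs x) = T.flowMeasure {x} := by
  have hq' : (q : ℝ) ≠ 0 := Nat.cast_ne_zero.2 hq.ne'
  rw [← (T.finite_succs x).coe_toFinset, ← sum_measure_singleton]
  have h : ∀ y ∈ (T.finite_succs x).toFinset,
      T.flowMeasure {y} = ENNReal.ofReal (T.flow x / q) := fun y hy => by
    rw [flowMeasure_singleton, T.flow_of_mem_succs hq ((T.finite_succs x).mem_toFinset.1 hy)]
  rw [Finset.sum_congr rfl h, Finset.sum_const, ← Set.ncard_eq_toFinset_card _ (T.finite_succs x),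
    ncard_succs, flowMeasure_singleton, nsmul_eq_mul, ← ENNReal.ofReal_natCast,
    ← ENNReal.ofReal_mul (Nat.cast_nonneg q), mul_div_cancel₀ _ hq']

theorem measurePreserving_pred (hq : 0 < q) :
    MeasurePreserving T.pred T.flowMeasure T.flowMeasure := by
  refine ⟨Measurable.of_discrete, ?_⟩
  have := T.countable_vertices
  refine Measure.ext_of_singleton fun x => ?_
  rw [Measure.map_apply Measurable.of_discrete MeasurableSet.of_discrete, ← succs_eq_preimage,
    T.flowMeasure_succs hq]

/-- The isometry `f ↦ f ∘ 𝔭` of `L²(μ)`. -/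
noncomputable def shift (hq : 0 < q) : T.L2 →L[ℂ] T.L2 :=
  (Lp.compMeasurePreservingₗᵢ ℂ T.pred (T.measurePreserving_pred hq)).toContinuousLinearMap

theorem shift_apply (hq : 0 < q) (f : T.L2) (x : V) : T.shift hq f x = f (T.pred x) :=
  T.forall_of_ae hq (Lp.coeFn_compMeasurePreserving f (T.measurePreserving_pred hq)) x

theorem adjoint_shift_shift (hq : 0 < q) (f : T.L2) :
    ContinuousLinearMap.adjoint (T.shift hq) (T.shift hq f) = f := by
  refine ext_inner_left ℂ fun g => ?_
  rw [ContinuousLinearMap.adjoint_inner_right]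
  exact (Lp.compMeasurePreservingₗᵢ ℂ T.pred (T.measurePreserving_pred hq)).inner_map_map g f

/-- The indicator function of a set of finite measure as an element of `L²(μ)`. -/
noncomputable def indicatorL2 {s : Set V} (hs : T.flowMeasure s ≠ ∞) : T.L2 :=
  indicatorConstLp 2 MeasurableSet.of_discrete hs 1

theorem indicatorL2_apply (hq : 0 < q) {s : Set V} (hs : T.flowMeasure s ≠ ∞) (x : V) :
    T.indicatorL2 hs x = s.indicator 1 x :=
  T.forall_of_ae hq indicatorConstLp_coeFn x

theorem inner_indicatorL2 {s t : Set V} (hs : T.flowMeasure s ≠ ∞) (ht : T.flowMeasure t ≠ ∞) :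
    inner ℂ (T.indicatorL2 hs) (T.indicatorL2 ht) = T.flowMeasure.real (s ∩ t) :=
  L2.inner_indicatorConstLp_one_indicatorConstLp_one _ _ _ _

theorem inner_indicatorL2_of_finite (hq : 0 < q) {s : Finset V}
    (hs : T.flowMeasure (s : Set V) ≠ ∞) (f : T.L2) :
    inner ℂ (T.indicatorL2 hs) f = ∑ x ∈ s, (T.flow x : ℂ) * f x := by
  rw [indicatorL2, L2.inner_indicatorConstLp_one, setIntegral_finset]
  · simp only [T.flowMeasure_real_singleton hq, Complex.real_smul]
  · exact integrableOn_Lp_of_measure_ne_top f fact_one_le_two_ennreal.elim hs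

theorem inner_indicatorL2_singleton (hq : 0 < q) (x : V) (f : T.L2) :
    inner ℂ (T.indicatorL2 (T.flowMeasure_singleton_ne_top x)) f = (T.flow x : ℂ) * f x := by
  have h := T.inner_indicatorL2_of_finite hq (s := {x})
    (by simpa using T.flowMeasure_singleton_ne_top x) f
  simpa using h

theorem flowMeasure_preimage_iterate (hq : 0 < q) (n : ℕ) (s : Set V) :
    T.flowMeasure (T.pred^[n] ⁻¹' s) = T.flowMeasure s :=
  ((T.measurePreserving_pred hq).iterate n).measure_preimage
    MeasurableSet.of_discrete.nullMeasurableSet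

theorem shift_iterate_apply (hq : 0 < q) (n : ℕ) (f : T.L2) (x : V) :
    ((T.shift hq)^[n] f) x = f (T.pred^[n] x) := by
  induction n generalizing x with
  | zero => rfl
  | succ n ih => rw [Function.iterate_succ_apply', shift_apply, ih, Function.iterate_succ_apply]

theorem shift_iterate_indicatorL2 (hq : 0 < q) (n : ℕ) {s : Set V} (hs : T.flowMeasure s ≠ ∞) :
    (T.shift hq)^[n] (T.indicatorL2 hs) =
      T.indicatorL2 ((T.flowMeasure_preimage_iterate hq n s).trans_ne hs) := by
  refine T.L2_ext fun x => ?_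
  rw [shift_iterate_apply, indicatorL2_apply _ hq, indicatorL2_apply _ hq]
  rfl

/-- Pair with the indicator of `{x}`, which the shift carries to the indicator of the successors,
each of mass `μ(x)/q`. -/
theorem adjoint_shift_apply (hq : 0 < q) (f : T.L2) (x : V) :
    ContinuousLinearMap.adjoint (T.shift hq) f x = (q : ℂ)⁻¹ * ∑ᶠ y ∈ T.succs x, f y := by
  have hq' : (q : ℂ) ≠ 0 := Nat.cast_ne_zero.2 hq.ne'
  have hx : (T.flow x : ℂ) ≠ 0 := Complex.ofReal_ne_zero.2 (T.flow_pos hq x).ne'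
  have hF : T.flowMeasure ((T.finite_succs x).toFinset : Set V) ≠ ∞ := by
    rw [Set.Finite.coe_toFinset, T.flowMeasure_succs hq]
    exact T.flowMeasure_singleton_ne_top x
  have h : T.shift hq (T.indicatorL2 (T.flowMeasure_singleton_ne_top x)) = T.indicatorL2 hF := by
    refine T.L2_ext fun y => ?_
    rw [shift_apply, indicatorL2_apply _ hq, indicatorL2_apply _ hq, Set.Finite.coe_toFinset,
      succs_eq_preimage]
    rfl
  have h2 := T.inner_indicatorL2_singleton hq x (ContinuousLinearMap.adjoint (T.shift hq) f)
  rw [ContinuousLinearMap.adjoint_inner_right, h, T.inner_indicatorL2_of_finite hq] at h2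
  rw [finsum_mem_eq_finite_toFinset_sum _ (T.finite_succs x)]
  refine mul_left_cancel₀ hx ?_
  rw [← h2, Finset.mul_sum, Finset.mul_sum]
  refine Finset.sum_congr rfl fun y hy => ?_
  rw [T.flow_of_mem_succs hq ((T.finite_succs x).mem_toFinset.1 hy)]
  push_cast
  ring

theorem onL2_eq (hq : 0 < q) {A : (V → ℂ) → V → ℂ} {B : T.L2 →L[ℂ] T.L2}
    (h : ∀ f x, B f x = A f x) : T.onL2 A = B := by
  have hex : ∃ B : T.L2 →L[ℂ] T.L2, ∀ f : T.L2, B f =ᵐ[T.flowMeasure] A f :=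
    ⟨B, fun f => Eventually.of_forall (h f)⟩
  rw [onL2, dif_pos hex]
  ext1 f
  refine T.L2_ext fun x => ?_
  rw [h, T.forall_of_ae hq (hex.choose_spec f) x]

theorem gradientL2_eq (hq : 0 < q) : T.gradientL2 = 1 - T.shift hq :=
  T.onL2_eq hq fun f x => by
    rw [gradient, ← T.shift_apply hq]
    exact T.forall_of_ae hq (Lp.coeFn_sub f (T.shift hq f)) x

/-- The weight `√(μ(y)/μ(x))` is `√q` at the predecessor and `1/√q` at the successors; after the
factor `1/(2√q)` these become the coefficients `1/2` of `S` and `1/(2q)` of the sum defining `S†`.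
-/
theorem laplacianL2_eq (hq : 0 < q) : T.laplacianL2 = isometryLaplacian (T.shift hq) := by
  refine T.onL2_eq hq fun f x => ?_
  set g := ContinuousLinearMap.adjoint (T.shift hq) f with hg
  have hq' : (0 : ℝ) < q := Nat.cast_pos.2 hq
  have hx := T.flow_pos hq x
  have h1 := T.forall_of_ae hq (Lp.coeFn_sub f ((1 / 2 : ℂ) • (T.shift hq f + g))) x
  have h2 := T.forall_of_ae hq (Lp.coeFn_smul (1 / 2 : ℂ) (T.shift hq f + g)) x
  have h3 := T.forall_of_ae hq (Lp.coeFn_add (T.shift hq f) g) x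
  have hsum : ∑ᶠ y ∈ T.succs x, ((√(T.flow y) / √(T.flow x) : ℝ) : ℂ) * f y =
      (√(q : ℝ) : ℂ)⁻¹ * ∑ᶠ y ∈ T.succs x, f y := by
    rw [mul_finsum_mem]
    refine finsum_mem_congr rfl fun y hy => ?_
    rw [T.flow_of_mem_succs hq hy, Real.sqrt_div' _ hq'.le, div_right_comm,
      div_self (Real.sqrt_pos.2 hx).ne', one_div, Complex.ofReal_inv]
  rw [isometryLaplacian_apply, ← hg, h1, Pi.sub_apply, h2, Pi.smul_apply, h3, Pi.add_apply,
    T.shift_apply, hg, T.adjoint_shift_apply, laplacian, neighborSet_eq,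
    finsum_mem_insert _ (T.pred_notMem_succs x) (T.finite_succs x), T.flow_pred hq,
    hsum, Real.sqrt_mul hq'.le, mul_div_cancel_right₀ _ (Real.sqrt_pos.2 hx).ne']
  have h4 : (√(q : ℝ) : ℂ) ≠ 0 := Complex.ofReal_ne_zero.2 (Real.sqrt_pos.2 hq').ne'
  have h5 : (q : ℂ) = (√(q : ℝ) : ℂ) ^ 2 := by
    rw [← Complex.ofReal_pow, Real.sq_sqrt hq'.le, Complex.ofReal_natCast]
  rw [h5, smul_eq_mul]
  field_simp

/-- A function in the kernel satisfies `f = S f`, so it is constant along predecessors, whose masses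
grow like `qⁿ`; square integrability forces it to vanish. -/
theorem isometryLaplacian_shift_injective (hq : 2 ≤ q) (f : T.L2)
    (hf : isometryLaplacian (T.shift (by omega)) f = 0) : f = 0 := by
  have hq0 : 0 < q := by omega
  have h := inner_sub_isometry_self (T.adjoint_shift_shift hq0) f
  rw [hf, inner_zero_right, mul_zero, inner_self_eq_zero, sub_eq_zero] at h
  have hiter : ∀ n x, f (T.pred^[n] x) = f x := by
    intro n x
    rw [← T.shift_iterate_apply hq0, Function.iterate_fixed h.symm]
  have hbound : ∀ x, T.flow x * ‖f x‖ ^ 2 ≤ ‖f‖ ^ 2 := by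
    intro x
    have h1 := norm_inner_le_norm (𝕜 := ℂ)
      (T.indicatorL2 (T.flowMeasure_singleton_ne_top x)) f
    have h2 : ‖T.indicatorL2 (T.flowMeasure_singleton_ne_top x)‖ ^ 2 = T.flow x := by
      have := T.inner_indicatorL2 (T.flowMeasure_singleton_ne_top x)
        (T.flowMeasure_singleton_ne_top x)
      rw [inner_self_eq_norm_sq_to_K, Set.inter_self, T.flowMeasure_real_singleton hq0] at this
      rw [← Complex.ofReal_inj]
      push_cast
      exact this
    rw [T.inner_indicatorL2_singleton hq0, norm_mul, Complex.norm_real,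
      Real.norm_of_nonneg (T.flow_pos hq0 x).le] at h1
    have h3 := pow_le_pow_left₀
      (mul_nonneg (T.flow_pos hq0 x).le (norm_nonneg _)) h1 2
    rw [mul_pow, mul_pow, h2, sq (T.flow x), mul_assoc] at h3
    exact le_of_mul_le_mul_left h3 (T.flow_pos hq0 x)
  refine T.L2_ext fun x => ?_
  rw [T.forall_of_ae hq0 (Lp.coeFn_zero ℂ 2 T.flowMeasure) x, Pi.zero_apply]
  by_contra hne
  have hpos : 0 < T.flow x * ‖f x‖ ^ 2 := by
    have := T.flow_pos hq0 x
    positivity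
  obtain ⟨n, hn⟩ := pow_unbounded_of_one_lt (‖f‖ ^ 2 / (T.flow x * ‖f x‖ ^ 2))
    (show (1 : ℝ) < q by exact_mod_cast hq)
  have h1 := hbound (T.pred^[n] x)
  have h2 : T.flow (T.pred^[n] x) = (q : ℝ) ^ n * T.flow x := by
    rw [flow, flow, level_iterate_pred, add_comm, zpow_add₀ (Nat.cast_ne_zero.2 hq0.ne'),
      zpow_natCast]
  rw [hiter, h2, mul_assoc] at h1
  rw [div_lt_iff₀ hpos] at hn
  linarith

theorem riesz_operatorSqrt (hq : 2 ≤ q) (f : T.L2) :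
    T.riesz (operatorSqrt (isometryLaplacian (T.shift (by omega))) f) =
      f - T.shift (by omega) f := by
  have hq0 : 0 < q := by omega
  rw [riesz, invSqrtLaplacian, T.gradientL2_eq hq0, T.laplacianL2_eq hq0]
  exact extendOfNorm_operatorInvSqrt (T.adjoint_shift_shift hq0)
    (T.isometryLaplacian_shift_injective hq) f

theorem hasSum_rieszAdjoint (hq : 2 ≤ q) {a : T.L2}
    (ha : ContinuousLinearMap.adjoint (T.shift (by omega)) a = 0) :
    HasSum (fun n => (rieszCoeff n : ℂ) • (T.shift (by omega))^[n] a) (T.rieszAdjoint a) :=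
  hasSum_rieszCoeff_smul (T.adjoint_shift_shift _) (T.isometryLaplacian_shift_injective hq) ha
    (adjoint_apply_of_comp_operatorSqrt (T.riesz_operatorSqrt hq) ha)

theorem hasSum_inner_riesz (hq : 2 ≤ q) {a : T.L2}
    (ha : ContinuousLinearMap.adjoint (T.shift (by omega)) a = 0) (f : T.L2) :
    HasSum (fun n => (rieszCoeff n : ℂ) * inner ℂ ((T.shift (by omega))^[n] a) f)
      (inner ℂ a (T.riesz f)) := by
  have h := (T.hasSum_rieszAdjoint hq ha).mapL (innerSL ℂ f)
  have h2 := h.map (starRingEnd ℂ) Complex.continuous_conj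
  rw [innerSL_apply_apply, inner_conj_symm, rieszAdjoint,
    ContinuousLinearMap.adjoint_inner_left] at h2
  convert! h2 using 2 with n
  rw [Function.comp_apply, innerSL_apply_apply, inner_smul_right, map_mul, inner_conj_symm,
    Complex.conj_ofReal]

end HomogeneousTree

/-! ### Divergence, atoms and the counterexamples -/

theorem tendsto_sum_rieszCoeff_atTop :
    Tendsto (fun N => ∑ n ∈ Finset.range N, rieszCoeff n) atTop atTop := by
  have hc : 0 < 2 * √2 / Real.pi := by
    have := Real.pi_pos
    positivity
  refine tendsto_atTop_mono (fun N => ?_)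
    (Real.tendsto_sum_range_one_div_nat_succ_atTop.const_mul_atTop hc)
  rw [Finset.mul_sum]
  refine Finset.sum_le_sum fun n _ => ?_
  have hn : (0 : ℝ) ≤ n := n.cast_nonneg
  rw [rieszCoeff_eq]
  refine mul_le_mul_of_nonneg_left ?_ hc.le
  rw [div_le_div_iff₀ (by positivity) (by nlinarith)]
  nlinarith

namespace HomogeneousTree

variable {V : Type*} {q : ℕ} (T : HomogeneousTree V q)

/-- The descendants of `x` at distance at most `N`. -/
def descendantBall (x : V) (N : ℕ) : Set V := {y | ∃ n ≤ N, T.pred^[n] y = x}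

theorem eq_of_iterate_pred_eq {x y z : V} {m n : ℕ} (hxy : T.level x = T.level y)
    (hx : T.pred^[m] z = x) (hy : T.pred^[n] z = y) : m = n := by
  rw [← hx, ← hy, level_iterate_pred, level_iterate_pred] at hxy
  omega

theorem level_of_mem_succs {x y : V} (h : y ∈ T.succs x) : T.level y = T.level x - 1 := by
  rw [← T.mem_succs_iff.1 h, level_pred]
  ring

variable [MeasurableSpace V]

theorem isAtomicDecomposition_single {a : V → ℂ} (ha : T.IsAtom a) :
    T.IsAtomicDecomposition a (Pi.single 0 1) fun _ => a := by
  refine ⟨summable_of_ne_finset_zero (s := {0}) fun j hj => ?_, fun _ => ha, fun x => ?_⟩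
  · rw [Pi.single_eq_of_ne (by simpa using hj), norm_zero]
  · convert! hasSum_single (f := fun j => (Pi.single 0 1 : ℕ → ℂ) j * a x) 0 fun j hj => ?_ using 1
    · simp
    · rw [Pi.single_eq_of_ne hj, zero_mul]

theorem hardyNorm_le_one {a : V → ℂ} (ha : T.IsAtom a) : T.hardyNorm a ≤ 1 := by
  rw [hardyNorm]
  refine iInf_le_of_le (Pi.single 0 1) (iInf_le_of_le (fun _ => a)
    (iInf_le_of_le (T.isAtomicDecomposition_single ha) ?_))
  rw [tsum_eq_single 0 fun j hj => by rw [Pi.single_eq_of_ne hj, enorm_zero]]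
  simp

variable [DiscreteMeasurableSpace V]

theorem flowMeasure_descendantBall_le (hq : 0 < q) (x : V) (N : ℕ) :
    T.flowMeasure (T.descendantBall x N) ≤ ENNReal.ofReal ((N + 1) * T.flow x) := by
  have h : T.descendantBall x N ⊆ ⋃ n ∈ Finset.range (N + 1), T.pred^[n] ⁻¹' {x} := by
    rintro y ⟨n, hn, hy⟩
    exact Set.mem_biUnion (by simpa [Nat.lt_succ_iff] using hn) hy
  refine (measure_mono h).trans ((measure_biUnion_finset_le _ _).trans ?_)
  simp only [T.flowMeasure_preimage_iterate hq, flowMeasure_singleton]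
  rw [Finset.sum_const, Finset.card_range, nsmul_eq_mul, ENNReal.ofReal_mul (by positivity)]
  gcongr
  rw [← ENNReal.ofReal_natCast]
  push_cast
  rfl

theorem flowMeasure_descendantBall_ne_top (hq : 0 < q) (x : V) (N : ℕ) :
    T.flowMeasure (T.descendantBall x N) ≠ ∞ :=
  ne_top_of_le_ne_top ENNReal.ofReal_ne_top (T.flowMeasure_descendantBall_le hq x N)

/-- The difference `δ_x - δ_y` as an element of `L²(μ)`. -/
noncomputable def vertexDiff (x y : V) : T.L2 :=
  T.indicatorL2 (T.flowMeasure_singleton_ne_top x) -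
    T.indicatorL2 (T.flowMeasure_singleton_ne_top y)

theorem vertexDiff_apply (hq : 0 < q) (x y z : V) :
    T.vertexDiff x y z = Set.indicator {x} 1 z - Set.indicator {y} 1 z := by
  rw [← T.indicatorL2_apply hq (T.flowMeasure_singleton_ne_top x),
    ← T.indicatorL2_apply hq (T.flowMeasure_singleton_ne_top y)]
  exact T.forall_of_ae hq (Lp.coeFn_sub _ _) z

theorem inner_vertexDiff (hq : 0 < q) (x y : V) (f : T.L2) :
    inner ℂ (T.vertexDiff x y) f = (T.flow x : ℂ) * f x - (T.flow y : ℂ) * f y := by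
  rw [vertexDiff, inner_sub_left, T.inner_indicatorL2_singleton hq,
    T.inner_indicatorL2_singleton hq]

theorem adjoint_shift_vertexDiff (hq : 0 < q) {v x y : V} (hx : x ∈ T.succs v)
    (hy : y ∈ T.succs v) :
    ContinuousLinearMap.adjoint (T.shift hq) (T.vertexDiff x y) = 0 := by
  refine ext_inner_right ℂ fun f => ?_
  rw [ContinuousLinearMap.adjoint_inner_left, inner_zero_left, T.inner_vertexDiff hq,
    T.shift_apply, T.shift_apply, T.mem_succs_iff.1 hx, T.mem_succs_iff.1 hy,
    T.flow_of_mem_succs hq hx, T.flow_of_mem_succs hq hy, sub_self]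

theorem inner_shift_iterate_vertexDiff (hq : 0 < q) (n : ℕ) (x y : V) {s : Set V}
    (hs : T.flowMeasure s ≠ ∞) :
    inner ℂ ((T.shift hq)^[n] (T.vertexDiff x y)) (T.indicatorL2 hs) =
      ((T.flowMeasure.real (T.pred^[n] ⁻¹' {x} ∩ s) -
        T.flowMeasure.real (T.pred^[n] ⁻¹' {y} ∩ s) : ℝ) : ℂ) := by
  rw [vertexDiff, iterate_map_sub, shift_iterate_indicatorL2, shift_iterate_indicatorL2,
    inner_sub_left, inner_indicatorL2, inner_indicatorL2]
  push_cast
  rfl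

/-- If `s` contains exactly the generations `0, …, N` below `x` and nothing below `y`, the series
for the pairing stops at `N`. What `s` contains elsewhere is irrelevant, which permits its use both
for one truncated cone and for a union of them. -/
theorem inner_vertexDiff_riesz (hq : 2 ≤ q) {v x y : V} (hx : x ∈ T.succs v)
    (hy : y ∈ T.succs v) {s : Set V} (hs : T.flowMeasure s ≠ ∞) {N : ℕ}
    (hsx : ∀ n z, T.pred^[n] z = x → (z ∈ s ↔ n ≤ N))
    (hsy : ∀ n z, T.pred^[n] z = y → z ∉ s) :
    inner ℂ (T.vertexDiff x y) (T.riesz (T.indicatorL2 hs)) =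
      ((T.flow x * ∑ n ∈ Finset.range (N + 1), rieszCoeff n : ℝ) : ℂ) := by
  have hq0 : 0 < q := by omega
  have hterm : ∀ n, inner ℂ ((T.shift hq0)^[n] (T.vertexDiff x y)) (T.indicatorL2 hs) =
      ((if n ≤ N then T.flow x else 0 : ℝ) : ℂ) := by
    intro n
    have hy' : T.pred^[n] ⁻¹' {y} ∩ s = ∅ :=
      Set.eq_empty_of_forall_notMem fun z hz => hsy n z hz.1 hz.2
    rw [inner_shift_iterate_vertexDiff, hy', measureReal_empty, sub_zero]
    congr 1
    split_ifs with hn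
    · have h1 : T.pred^[n] ⁻¹' {x} ∩ s = T.pred^[n] ⁻¹' {x} :=
        Set.inter_eq_left.2 fun z hz => (hsx n z hz).2 hn
      rw [h1, measureReal_def, T.flowMeasure_preimage_iterate hq0, ← measureReal_def, T.flowMeasure_real_singleton hq0]
    · have h1 : T.pred^[n] ⁻¹' {x} ∩ s = ∅ :=
        Set.eq_empty_of_forall_notMem fun z hz => hn ((hsx n z hz.1).1 hz.2)
      rw [h1, measureReal_empty]
  have h := T.hasSum_inner_riesz hq (T.adjoint_shift_vertexDiff hq0 hx hy) (T.indicatorL2 hs)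
  simp only [hterm] at h
  rw [h.unique (hasSum_sum_of_ne_finset_zero (s := Finset.range (N + 1)) fun n hn => ?_)]
  · rw [Finset.mul_sum]
    push_cast
    refine Finset.sum_congr rfl fun n hn => ?_
    rw [if_pos (Nat.lt_succ_iff.1 (Finset.mem_range.1 hn)), mul_comm]
  · rw [if_neg (by simpa [Nat.lt_succ_iff] using hn), Complex.ofReal_zero, mul_zero]

theorem inner_vertexDiff_riesz_descendantBall (hq : 2 ≤ q) {v x y : V} (hx : x ∈ T.succs v)
    (hy : y ∈ T.succs v) (hxy : x ≠ y) (N : ℕ) :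
    inner ℂ (T.vertexDiff x y)
      (T.riesz (T.indicatorL2 (T.flowMeasure_descendantBall_ne_top (by omega) x N))) =
      ((T.flow x * ∑ n ∈ Finset.range (N + 1), rieszCoeff n : ℝ) : ℂ) := by
  refine T.inner_vertexDiff_riesz hq hx hy _ (fun n z hz => ⟨?_, fun hn => ⟨n, hn, hz⟩⟩) ?_
  · rintro ⟨m, hm, hmz⟩
    rwa [T.eq_of_iterate_pred_eq rfl hz hmz]
  · rintro n z hz ⟨m, -, hmz⟩
    have := T.eq_of_iterate_pred_eq (by rw [T.level_of_mem_succs hx, T.level_of_mem_succs hy])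
      hmz hz
    exact hxy (by rw [← hmz, ← hz, this])

/-- Test the seminorm on the sibling set: `x` and `y` each carry the fraction `1/q` of its mass, and
the triangle inequality removes the mean. -/
theorem enorm_sub_div_le_bmoSeminorm (hq : 0 < q) {v x y : V} (hx : x ∈ T.succs v)
    (hy : y ∈ T.succs v) (hxy : x ≠ y) (g : V → ℂ) :
    ‖g x - g y‖ₑ / q ≤ T.bmoSeminorm g := by
  refine le_trans ?_ (le_iSup₂ (f := fun (F : Set V) (_ : T.IsAdmissible F) =>
    ⨍⁻ x in F, ‖g x - ⨍ y in F, g y ∂T.flowMeasure‖ₑ ∂T.flowMeasure)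
    (T.succs v) (T.isAdmissible_succs v))
  set m := ⨍ y in T.succs v, g y ∂T.flowMeasure
  classical
  have hsub : (({x, y} : Finset V) : Set V) ⊆ T.succs v := by
    intro z hz
    rw [Finset.coe_insert, Finset.coe_singleton] at hz
    rcases hz with rfl | rfl
    exacts [hx, hy]
  have hfx : T.flowMeasure {y} = T.flowMeasure {x} := by
    rw [flowMeasure_singleton, flowMeasure_singleton, T.flow_of_mem_succs hq hx,
      T.flow_of_mem_succs hq hy]
  have hx0 : T.flowMeasure {x} ≠ 0 := by
    rw [flowMeasure_singleton, ne_eq, ENNReal.ofReal_eq_zero, not_le]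
    exact T.flow_pos hq x
  have hF : T.flowMeasure (T.succs v) = q * T.flowMeasure {x} := by
    rw [T.flowMeasure_succs hq, flowMeasure_singleton, flowMeasure_singleton,
      T.flow_of_mem_succs hq hx, ← ENNReal.ofReal_natCast, ← ENNReal.ofReal_mul q.cast_nonneg,
      mul_div_cancel₀ _ (Nat.cast_ne_zero.2 hq.ne')]
  have h1 : ‖g x - g y‖ₑ * T.flowMeasure {x} ≤
      ∫⁻ z in T.succs v, ‖g z - m‖ₑ ∂T.flowMeasure := by
    refine le_trans ?_ (lintegral_mono_set hsub)
    rw [lintegral_finset, Finset.sum_pair hxy, hfx, ← add_mul]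
    gcongr
    rw [← sub_sub_sub_cancel_right (g x) (g y) m]
    exact enorm_sub_le
  rw [setLAverage_eq, hF, mul_comm (q : ℝ≥0∞)]
  calc ‖g x - g y‖ₑ / q = ‖g x - g y‖ₑ * T.flowMeasure {x} / (T.flowMeasure {x} * q) := by
        rw [mul_comm, ENNReal.mul_div_mul_left _ _ hx0 (T.flowMeasure_singleton_ne_top x)]
    _ ≤ _ := ENNReal.div_le_div_right h1 _

theorem memLp_top_indicatorL2 (hq : 0 < q) {s : Set V} (hs : T.flowMeasure s ≠ ∞) :
    MemLp (T.indicatorL2 hs) ∞ T.flowMeasure := by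
  refine memLp_top_of_bound (Lp.aestronglyMeasurable _) 1 (Eventually.of_forall fun x => ?_)
  rw [T.indicatorL2_apply hq]
  by_cases hx : x ∈ s <;> simp [hx]

theorem isAtom_vertexDiff (hq : 0 < q) {x y : V} (hx : x ∈ T.succs T.origin)
    (hy : y ∈ T.succs T.origin) : T.IsAtom (T.vertexDiff x y) := by
  have hfun : (T.vertexDiff x y : V → ℂ) =
      fun z => Set.indicator {x} 1 z - Set.indicator {y} 1 z :=
    funext (T.vertexDiff_apply hq x y)
  refine ⟨T.succs T.origin, T.isAdmissible_succs _, fun z hz => ?_, fun z => ?_, ?_⟩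
  · by_contra hz'
    refine hz ?_
    rw [hfun]
    have h1 : z ∉ ({x} : Set V) := by rintro rfl; exact hz' hx
    have h2 : z ∉ ({y} : Set V) := by rintro rfl; exact hz' hy
    simp only [Set.indicator_of_notMem h1, Set.indicator_of_notMem h2, sub_zero]
  -- The level of the origin is `0`, so the sibling set has mass `1` and the difference needs no
  -- normalising factor.
  · have h1 : T.flowMeasure.real (T.succs T.origin) = 1 := by
      rw [measureReal_def, T.flowMeasure_succs hq, ← measureReal_def,
        T.flowMeasure_real_singleton hq, flow, level_origin, zpow_zero]
    rw [h1, inv_one, hfun]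
    by_cases h2 : z ∈ ({x} : Set V) <;> by_cases h3 : z ∈ ({y} : Set V) <;> simp [h2, h3]
  · have hint : ∀ z, Integrable (Set.indicator {z} (1 : V → ℂ)) T.flowMeasure := fun z =>
      (integrable_indicator_iff MeasurableSet.of_discrete).2
        (integrableOn_const (T.flowMeasure_singleton_ne_top z))
    have hval : ∀ z, ∫ w, Set.indicator {z} (1 : V → ℂ) w ∂T.flowMeasure = T.flow z := fun z => by
      rw [integral_indicator MeasurableSet.of_discrete]
      simp [← measureReal_def, T.flowMeasure_real_singleton hq]
    rw [hfun, integral_sub (hint x) (hint y), hval, hval, T.flow_of_mem_succs hq hx,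
      T.flow_of_mem_succs hq hy, sub_self]

theorem integral_mul_vertexDiff (hq : 0 < q) (x y : V) (f : T.L2) :
    ∫ z, f z * T.vertexDiff x y z ∂T.flowMeasure = inner ℂ (T.vertexDiff x y) f := by
  rw [L2.inner_def]
  congr 1
  ext z
  rw [RCLike.inner_apply]
  congr 1
  -- The inner product conjugates its first argument, which is real-valued here.
  rw [T.vertexDiff_apply hq]
  by_cases h2 : z ∈ ({x} : Set V) <;> by_cases h3 : z ∈ ({y} : Set V) <;> simp [h2, h3]

/-- The truncated indicators are bounded by `1`, so an integrable `𝓡† a` would bound all their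
pairings by its `L¹` norm. -/
theorem not_memLp_one_rieszAdjoint_vertexDiff (hq : 2 ≤ q) {v x y : V} (hx : x ∈ T.succs v)
    (hy : y ∈ T.succs v) (hxy : x ≠ y) :
    ¬ MemLp (T.rieszAdjoint (T.vertexDiff x y)) 1 T.flowMeasure := by
  intro h
  have hq0 : 0 < q := by omega
  have hint := (memLp_one_iff_integrable.1 h).norm
  obtain ⟨N, hN⟩ := ((tendsto_sum_rieszCoeff_atTop.comp (tendsto_add_atTop_nat 1)).const_mul_atTop
    (T.flow_pos hq0 x)).eventually_gt_atTop
      (∫ z, ‖T.rieszAdjoint (T.vertexDiff x y) z‖ ∂T.flowMeasure) |>.exists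
  have h1 := T.inner_vertexDiff_riesz_descendantBall hq hx hy hxy N
  rw [← ContinuousLinearMap.adjoint_inner_left] at h1
  have h2 := norm_integral_le_of_norm_le (f := fun z => inner ℂ
    (T.rieszAdjoint (T.vertexDiff x y) z)
    (T.indicatorL2 (T.flowMeasure_descendantBall_ne_top hq0 x N) z)) hint
    (Eventually.of_forall fun z => by
      refine (norm_inner_le_norm _ _).trans (mul_le_of_le_one_right (norm_nonneg _) ?_)
      rw [T.indicatorL2_apply hq0]
      by_cases hz : z ∈ T.descendantBall x N <;> simp [hz])
  rw [← L2.inner_def, rieszAdjoint, h1, Complex.norm_real] at h2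
  exact absurd (hN.trans_le (le_abs_self _)) (not_lt.2 h2)

theorem memHardy_vertexDiff (hq : 0 < q) {x y : V} (hx : x ∈ T.succs T.origin)
    (hy : y ∈ T.succs T.origin) : T.MemHardy (T.vertexDiff x y) := by
  refine ⟨?_, _, _, T.isAtomicDecomposition_single (T.isAtom_vertexDiff hq hx hy)⟩
  have hind : ∀ z, MemLp (T.indicatorL2 (T.flowMeasure_singleton_ne_top z)) 1 T.flowMeasure :=
    fun z => (memLp_indicator_const 1 (MeasurableSet.of_discrete (s := {z})) (1 : ℂ)
      (Or.inr (T.flowMeasure_singleton_ne_top z))).ae_eq indicatorConstLp_coeFn.symm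
  exact ((hind x).sub (hind y)).ae_eq (Lp.coeFn_sub _ _).symm

/-- Along the descending ray `w j`, the sibling `t (w j)` of `w (j + 1)` roots a subtree disjoint
from those of the other indices. Putting a cone of depth `j` below one successor of `t (w j)` makes
`𝓡 f` differ between two successors by `∑_{n ≤ j} cₙ`, with no interference from the other cones. -/
theorem exists_not_memBMO_riesz (hq : 2 ≤ q) :
    ∃ f : T.L2, MemLp f ∞ T.flowMeasure ∧ ¬ T.MemBMO (T.riesz f) := by
  have hq0 : 0 < q := by omega
  choose s t hs ht hst using T.exists_ne_mem_succs hq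
  have hps : Function.LeftInverse T.pred s := fun x => T.mem_succs_iff.1 (hs x)
  have hpt : Function.LeftInverse T.pred t := fun x => T.mem_succs_iff.1 (ht x)
  set w : ℕ → V := fun j => s^[j] T.origin with hw
  have hwlevel : ∀ j, T.level (w j) = -j := by
    intro j
    have h := T.level_iterate_pred j (w j)
    rw [hps.iterate j, level_origin] at h
    omega
  have hpw : ∀ k j, T.pred^[k] (w (k + j)) = w j := by
    intro k j
    rw [hw]
    simp only
    rw [Function.iterate_add_apply, hps.iterate k]
  -- A vertex below `t (w (i + k + 1))` lies below `w (i + 1) = s (w i)`, hence not below its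
  -- sibling `t (w i)`.
  have hlt : ∀ i k m n z, T.pred^[m] z = t (w i) → T.pred^[n] z = t (w (i + k + 1)) → False := by
    intro i k m n z h1 h2
    have h3 : T.pred^[k + 1] (t (w (i + k + 1))) = w (i + 1) := by
      rw [Function.iterate_succ_apply, hpt, show i + k + 1 = k + (i + 1) by ring, hpw]
    have h4 : T.pred^[k + 1 + n] z = w (i + 1) := by
      rw [Function.iterate_add_apply, h2, h3]
    have h5 : w (i + 1) = s (w i) := Function.iterate_succ_apply' s i T.origin
    have h6 := T.eq_of_iterate_pred_eq (by
      rw [h5, T.level_of_mem_succs (hs _), T.level_of_mem_succs (ht _)]) h4 h1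
    exact hst (w i) (by rw [← h5, ← h4, h6, h1])
  have hinj : ∀ i j m n z, T.pred^[m] z = t (w i) → T.pred^[n] z = t (w j) → i = j := by
    intro i j m n z h1 h2
    rcases lt_trichotomy i j with h | h | h
    · obtain ⟨k, rfl⟩ := Nat.exists_eq_add_of_lt h
      exact (hlt i k m n z h1 h2).elim
    · exact h
    · obtain ⟨k, rfl⟩ := Nat.exists_eq_add_of_lt h
      exact (hlt j k n m z h2 h1).elim
  have hstep : ∀ {x y z : V} {n : ℕ}, T.pred x = y → T.pred^[n] z = x → T.pred^[n + 1] z = y := by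
    intro x y z n h1 h2
    rw [Function.iterate_succ_apply', h2, h1]
  set E : Set V := ⋃ j, T.descendantBall (s (t (w j))) j with hE
  have hflow : ∀ j, T.flow (s (t (w j))) = (q : ℝ)⁻¹ ^ (j + 2) := by
    intro j
    rw [flow, T.level_of_mem_succs (hs _), T.level_of_mem_succs (ht _), hwlevel, inv_pow,
      ← zpow_natCast, ← zpow_neg]
    congr 1
    push_cast
    ring
  -- The `j`-th cone has mass at most `(j + 1) q^{-(j + 2)}`, which is summable; thus `f` is in
  -- `L²`.
  have hEfin : T.flowMeasure E ≠ ∞ := by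
    have hr : ‖(q : ℝ)⁻¹‖ < 1 := by
      rw [norm_inv, Real.norm_natCast]
      exact inv_lt_one_of_one_lt₀ (by exact_mod_cast hq)
    have hsum : Summable fun j : ℕ => ((j : ℝ) + 1) * (q : ℝ)⁻¹ ^ (j + 2) := by
      have h1 := summable_pow_mul_geometric_of_norm_lt_one 1 hr
      have h2 := ((h1.add (summable_geometric_of_norm_lt_one hr)).mul_right ((q : ℝ)⁻¹ ^ 2))
      refine h2.congr fun j => ?_
      rw [pow_add]
      ring
    refine ne_top_of_le_ne_top hsum.tsum_ofReal_ne_top ((measure_iUnion_le _).trans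
      (ENNReal.tsum_le_tsum fun j => ?_))
    rw [← hflow]
    exact T.flowMeasure_descendantBall_le hq0 _ _
  have key : ∀ j, inner ℂ (T.vertexDiff (s (t (w j))) (t (t (w j))))
      (T.riesz (T.indicatorL2 hEfin)) =
      ((T.flow (s (t (w j))) * ∑ n ∈ Finset.range (j + 1), rieszCoeff n : ℝ) : ℂ) := by
    intro j
    refine T.inner_vertexDiff_riesz hq (hs _) (ht _) hEfin (fun n z hz => ⟨fun hzE => ?_,
      fun hn => Set.mem_iUnion.2 ⟨j, n, hn, hz⟩⟩) fun n z hz hzE => ?_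
    · obtain ⟨i, m, hm, hmz⟩ := Set.mem_iUnion.1 hzE
      obtain rfl := hinj _ _ _ _ z (hstep (hps _) hmz) (hstep (hps _) hz)
      rwa [T.eq_of_iterate_pred_eq rfl hz hmz]
    · obtain ⟨i, m, hm, hmz⟩ := Set.mem_iUnion.1 hzE
      obtain rfl := hinj _ _ _ _ z (hstep (hps _) hmz) (hstep (hpt _) hz)
      have h := T.eq_of_iterate_pred_eq (by
        rw [T.level_of_mem_succs (hs _), T.level_of_mem_succs (ht (t _))]) hmz hz
      exact hst _ (by rw [← hmz, ← hz, h])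
  refine ⟨T.indicatorL2 hEfin, T.memLp_top_indicatorL2 hq0 hEfin, fun hbmo => ?_⟩
  set g := T.riesz (T.indicatorL2 hEfin)
  -- The two siblings have equal mass, so dividing the pairing by it leaves the difference of the
  -- values of `g`, which the seminorm controls uniformly in `j`.
  have hle : ∀ j, ∑ n ∈ Finset.range (j + 1), rieszCoeff n ≤ q * (T.bmoSeminorm g).toReal := by
    intro j
    have h1 := key j
    have hpos := T.flow_pos hq0 (s (t (w j)))
    rw [T.inner_vertexDiff hq0, T.flow_of_mem_succs hq0 (ht (t (w j))),
      ← T.flow_of_mem_succs hq0 (hs (t (w j))), ← mul_sub, Complex.ofReal_mul] at h1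
    have h2 := mul_left_cancel₀ (Complex.ofReal_ne_zero.2 hpos.ne') h1
    have h3 := T.enorm_sub_div_le_bmoSeminorm hq0 (hs (t (w j))) (ht (t (w j))) (hst _) g
    have h4 := ENNReal.toReal_mono hbmo.ne h3
    rw [h2, ENNReal.toReal_div, toReal_enorm, Complex.norm_real, ENNReal.toReal_natCast,
      div_le_iff₀ (Nat.cast_pos.2 hq0), mul_comm] at h4
    exact (le_abs_self _).trans h4
  obtain ⟨j, hj⟩ := ((tendsto_sum_rieszCoeff_atTop.comp (tendsto_add_atTop_nat 1)).eventually_gt_atTop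
    (q * (T.bmoSeminorm g).toReal)).exists
  exact absurd hj (not_lt.2 (hle j))

end HomogeneousTree

/-! ### The main theorem -/

theorem proposition4p4 {V : Type*} [MeasurableSpace V] [DiscreteMeasurableSpace V]
    {q : ℕ} (hq : 2 ≤ q) (T : HomogeneousTree V q) :
    -- the Riesz transform does not map bounded functions into `BMO(μ)`
    (∃ f : T.L2, MemLp f ∞ T.flowMeasure ∧ ¬ T.MemBMO (T.riesz f)) ∧
    (¬ ∃ C : ℝ≥0, ∀ f : T.L2, MemLp f ∞ T.flowMeasure →
      T.bmoSeminorm (T.riesz f) ≤ C * eLpNorm f ∞ T.flowMeasure) ∧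
    -- the witness: an atom, and the truncated indicators of the descendants of a vertex
    (∀ x₁ ∈ T.succs T.origin, ∀ x₂ ∈ T.succs T.origin, x₁ ≠ x₂ →
      ∃ (a : T.L2) (f : ℕ → T.L2),
        (∀ x, a x = Set.indicator {x₁} 1 x - Set.indicator {x₂} 1 x) ∧
        (∀ N x, f N x =
          Set.indicator {y | y ∈ T.descendants x₁ ∧ T.graph.dist x₁ y ≤ N} 1 x) ∧
        T.IsAtom a ∧
        (∀ N, ∫ x, T.riesz (f N) x * a x ∂T.flowMeasure =
          ((2 * √2 / (Real.pi * q) *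
            ∑ n ∈ Finset.range (N + 1), ((n : ℝ) + 1) / (((n : ℝ) + 1) ^ 2 - 1 / 4) : ℝ) : ℂ)) ∧
        Tendsto (fun N => (∫ x, T.riesz (f N) x * a x ∂T.flowMeasure).re) atTop atTop ∧
        ¬ MemLp (T.rieszAdjoint a) 1 T.flowMeasure) ∧
    -- the adjoint is not bounded from `H¹(μ)` to `L¹(μ)`
    (∃ g : T.L2, T.MemHardy g ∧ ¬ MemLp (T.rieszAdjoint g) 1 T.flowMeasure) ∧
    (¬ ∃ C : ℝ≥0, ∀ g : T.L2, T.MemHardy g →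
      eLpNorm (T.rieszAdjoint g) 1 T.flowMeasure ≤ C * T.hardyNorm g) := by
  have hq0 : 0 < q := by omega
  obtain ⟨f, hf, hbmo⟩ := T.exists_not_memBMO_riesz hq
  obtain ⟨y₁, y₂, hy₁, hy₂, hy⟩ := T.exists_ne_mem_succs hq T.origin
  have hadj := T.not_memLp_one_rieszAdjoint_vertexDiff hq hy₁ hy₂ hy
  have hhardy := T.memHardy_vertexDiff hq0 hy₁ hy₂
  refine ⟨⟨f, hf, hbmo⟩, fun ⟨C, hC⟩ => hbmo ((hC f hf).trans_lt
    (ENNReal.mul_lt_top ENNReal.coe_lt_top hf.eLpNorm_lt_top)), ?_,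
    ⟨_, hhardy, hadj⟩, fun ⟨C, hC⟩ => hadj ⟨Lp.aestronglyMeasurable _,
      (hC _ hhardy).trans_lt (ENNReal.mul_lt_top ENNReal.coe_lt_top
        ((T.hardyNorm_le_one (T.isAtom_vertexDiff hq0 hy₁ hy₂)).trans_lt ENNReal.one_lt_top))⟩⟩
  intro x₁ hx₁ x₂ hx₂ hx
  -- The factor `1/q` is the mass of `x₁`, a vertex of level `-1`.
  have key : ∀ N, ∫ x, T.riesz (T.indicatorL2 (T.flowMeasure_descendantBall_ne_top hq0 x₁ N)) x *
      T.vertexDiff x₁ x₂ x ∂T.flowMeasure =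
      (((q : ℝ)⁻¹ * ∑ n ∈ Finset.range (N + 1), rieszCoeff n : ℝ) : ℂ) := by
    intro N
    rw [T.integral_mul_vertexDiff hq0, T.inner_vertexDiff_riesz_descendantBall hq hx₁ hx₂ hx,
      T.flow_of_mem_succs hq0 hx₁, HomogeneousTree.flow, T.level_origin, zpow_zero, one_div]
  refine ⟨T.vertexDiff x₁ x₂,
    fun N => T.indicatorL2 (T.flowMeasure_descendantBall_ne_top hq0 x₁ N),
    T.vertexDiff_apply hq0 x₁ x₂, fun N x => ?_, T.isAtom_vertexDiff hq0 hx₁ hx₂, fun N => ?_, ?_,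
    T.not_memLp_one_rieszAdjoint_vertexDiff hq hx₁ hx₂ hx⟩
  · rw [T.indicatorL2_apply hq0]
    congr 1
    ext y
    exact T.mem_descendants_dist_le_iff.symm
  · rw [key]
    congr 1
    simp only [rieszCoeff_eq, ← Finset.mul_sum]
    rw [← mul_assoc]
    congr 1
    field_simp
  · simp only [key, Complex.ofReal_re]
    exact (tendsto_sum_rieszCoeff_atTop.comp (tendsto_add_atTop_nat 1)).const_mul_atTop
      (inv_pos.2 (Nat.cast_pos.2 hq0))
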